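/- **Theorem 1.2.** Let $3\le d\le 5$ be an integer and let $0<s<s_{cr}(d):=\frac d2-1$. Consider the defocusing quintic fourth-order Schrödinger equation on $\mathbb{R}^d$, $$ i\partial_t u+\Delta^2u+|u|^4u=0. \tag{1} $$ A solution of (1) on $[0,T]$ is a function $u\in C([0,T];H^2(\mathbb{R}^d;\mathbb{C}))$ which satisfies (1) in the sense of distributions on $\mathbb{R}^d$ at each time $t\in[0,T]$ (for $d\le5$ one has $|u|^4u\in L^2$ by the Sobolev embedding $H^2\subset L^{10}$): for every test function $\varphi\in C_c^\infty(\mathbb{R}^d;\mathbb{C})$ the function $t\mapsto\int u(t)\varphi\,dx$ is differentiable on $[0,T]$ (one-sidedly at the end points), with derivative $i\int u(t)\Delta^2\varphi\,dx+i\int|u(t)|^4u(t)\varphi\,dx$. Let $\|f\|_{H^s}=\|(1+|\xi|^2)^{s/2}\hat f\|_{L^2}$. Then equation (1) exhibits norm inflation at every $u_0\in H^s(\mathbb{R}^d;\mathbb{C})$: for every $\varepsilon>0$ there exist $T>0$, a solution $u$ of (1) on $[0,T]$ and a time $t\in(0,\varepsilon)$ with $t\le T$ such that $$\|u(0)-u_0\|_{H^s}<\varepsilon\qquad\text{and}\qquad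 \|u(t)\|_{H^s}>\varepsilon^{-1}.$$ -/

import Mathlib

open MeasureTheory Filter Topology
open scoped ENNReal FourierTransform ContDiff

namespace QuinticNLS

/-- The space `L²(ℝᵈ; ℂ)`. -/
abbrev L2 (d : ℕ) : Type :=
  Lp (α := EuclideanSpace ℝ (Fin d)) ℂ 2 volume

/-- The inhomogeneous Sobolev norm `‖f‖_{H^s} = ‖⟨ξ⟩^s f̂‖_{L²}`, `⟨ξ⟩ = (1 + |ξ|²)^{1/2}`, with
values in `[0, ∞]`.
`𝓕` is the unitary Fourier transform `f̂(η) = ∫ e^{-2πi x·η} f(x) dx` on `L²`, so that the frequency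
`ξ` of `e^{i x·ξ}` corresponds to `ξ = 2πη`. -/
noncomputable def sobolevNorm {d : ℕ} (s : ℝ) (f : L2 d) : ℝ≥0∞ :=
  eLpNorm (fun η : EuclideanSpace ℝ (Fin d) =>
    (((1 + (2 * Real.pi * ‖η‖) ^ 2) ^ (s / 2) : ℝ) : ℂ) * (𝓕 f : L2 d) η) 2 volume

/-- Membership in the Sobolev space `H^s(ℝᵈ)`, for `s ≥ 0` (so that `H^s ⊆ L²`). -/
def MemHs {d : ℕ} (s : ℝ) (f : L2 d) : Prop :=
  sobolevNorm s f < ⊤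

/-- The map `u` belongs to `C(J; H^s(ℝᵈ))`, for a set of times `J` and `s ≥ 0`. -/
def ContinuousOnHs {d : ℕ} (s : ℝ) (J : Set ℝ) (u : ℝ → L2 d) : Prop :=
  (∀ t ∈ J, MemHs s (u t)) ∧
    ∀ t ∈ J, Tendsto (fun τ => sobolevNorm s (u τ - u t)) (𝓝[J] t) (𝓝 0)

/-- `u` is a (strong, energy class) solution on the time interval `[0, T]` of
`i ∂ₜu + Δ²u + μ |u|⁴ u = 0`: it belongs to `C([0, T]; H²(ℝᵈ))` and, at every time `t` in `[0, T]`,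
`∂ₜu = i Δ²u + i μ |u|⁴ u` holds in the sense of distributions on `ℝᵈ`, that is, after pairing with
every test function `φ ∈ C_c^∞(ℝᵈ; ℂ)`.
Local integrability of `|u|⁴ u` makes the nonlinear term a distribution; in dimension `d ≤ 5` it
follows from the Sobolev embedding `H² ⊆ L¹⁰`. -/
structure IsSolution {d : ℕ} (μ : ℝ) (T : ℝ) (u : ℝ → L2 d) : Prop where
  continuousOn : ContinuousOnHs 2 (Set.Icc 0 T) u
  locallyIntegrable : ∀ t ∈ Set.Icc 0 T,
    LocallyIntegrable (fun x : EuclideanSpace ℝ (Fin d) => (‖u t x‖ : ℂ) ^ 4 * u t x) volume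
  equation : ∀ φ : EuclideanSpace ℝ (Fin d) → ℂ, ContDiff ℝ ∞ φ → HasCompactSupport φ →
    ∀ t ∈ Set.Icc 0 T,
      HasDerivWithinAt (fun τ : ℝ => ∫ x, u τ x * φ x)
        (Complex.I * (∫ x, u t x * Laplacian.laplacian (Laplacian.laplacian φ) x) +
          Complex.I * (μ : ℂ) * ∫ x, (‖u t x‖ : ℂ) ^ 4 * u t x * φ x)
        (Set.Icc 0 T) t

/-- The equation `i ∂ₜu + Δ²u + μ |u|⁴ u = 0` exhibits the norm inflation phenomenon at `u₀` in
`H^s(ℝᵈ)`: for every `ε > 0` there are a solution `u` and a time `t ∈ (0, ε)` of its interval of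
existence with `‖u(0) - u₀‖_{H^s} < ε` and `‖u(t)‖_{H^s} > ε⁻¹`. -/
def NormInflationAt {d : ℕ} (μ : ℝ) (s : ℝ) (u₀ : L2 d) : Prop :=
  ∀ ε : ℝ, 0 < ε → ∃ T : ℝ, 0 < T ∧ ∃ u : ℝ → L2 d, IsSolution μ T u ∧
    ∃ t : ℝ, 0 < t ∧ t < ε ∧ t ≤ T ∧
      sobolevNorm s (u 0 - u₀) < ENNReal.ofReal ε ∧
      ENNReal.ofReal ε⁻¹ < sobolevNorm s (u t)

/-- The scaling-critical Sobolev index `s_cr(d) = d/2 - 1`. -/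
noncomputable def sCrit (d : ℕ) : ℝ := (d : ℝ) / 2 - 1

end QuinticNLS

/-! Inflation is produced by a bubble so concentrated that its nonlinear evolution ends before
dispersion acts. Under u(t, x) = N v(N⁴t, nx) the equation becomes i∂v + δΔ²v + |v|⁴v = 0 with δ =
(n/N)⁴. For N = κ n^(d/2 - s) the H^s norm of the bubble Nψ(nx), n ≥ 1, is at most a multiple of κ,
while s < d/2 - 1 sends δ to 0 as n → ∞, together with the physical duration λ/N⁴ of any fixed
rescaled time λ.

For δ = 0 the equation is an ODE at each point, solved by e^{itψ⁴}ψ when ψ is real. Its modulus is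
conserved, but the level sets of a Gaussian ψ are null, and a Wiener-type averaging argument shows
that at suitable integer times at least half of the mass lies outside any prescribed ball of
frequencies (`exists_low_frequency_lt`, `Weight.exists_high_frequency`). Mass m beyond radius R
makes the H^s norm of the rescaled function at least κR^s√m, and R is free.

The delicate point is the background u₀. In rescaled variables its truncation to frequencies at most
M may have L² norm of order n^s, so it need not be small in L². It lives, however, at frequencies
O(1/n), and a factor |ξ|^j with j > s makes it small. The perturbation argument therefore runs in
the space of functions f with w f̂ ∈ L², w = ν⟨ξ⟩² + |ξ|^j(1 + |ξ|²). This space is an algebra whose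
constant is governed by the L² norm of 1/w, bounded uniformly in ν when 2j < d < 2j + 4. The term
with ν > 0 only places the space inside H², and ν may be chosen after n.

`Weight.exists_solution_near_dispersionless` yields a threshold δ₀ common to all these weights,
`isSolution_synth` returns to the original equation, and `normInflationAt_of_polyWeight` fixes the
parameters in the order M, κ, R, λ, δ₀, n, ν. -/

set_option linter.unusedSectionVars false

namespace QuinticNLS

variable {V : Type*} [NormedAddCommGroup V] [InnerProductSpace ℝ V] [FiniteDimensional ℝ V]
  [MeasurableSpace V] [BorelSpace V]

/-- The space `L²(V; ℂ)`. -/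
abbrev LSq (V : Type*) [NormedAddCommGroup V] [InnerProductSpace ℝ V] [FiniteDimensional ℝ V]
    [MeasurableSpace V] [BorelSpace V] : Type _ :=
  Lp (α := V) ℂ 2 volume

/-! ### The Fourier integral and the Fourier transform on L². -/

section FourierCompatibility

/-- The inverse Fourier transform of an integrable function, paired with a Schwartz function. -/
theorem integral_fourierInv_mul_eq {f g : V → ℂ} (hf : Integrable f) (hg : Integrable g) :
    ∫ x, 𝓕⁻ f x * g x = ∫ ξ, f ξ * 𝓕⁻ g ξ := by
  have h := VectorFourier.integral_fourierIntegral_smul_eq_flip (L := innerₗ V)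
    Real.continuous_fourierChar continuous_inner hf (g := fun x => g (-x)) hg.comp_neg
  have h1 : ∀ x, 𝓕⁻ f x = 𝓕 f (-x) := fun x => Real.fourierInv_eq_fourier_neg f x
  have h2 : ∀ x, 𝓕⁻ g x = 𝓕 (fun y => g (-y)) x := fun x => by
    rw [Real.fourierInv_eq_fourier_comp_neg]
  rw [flip_innerₗ] at h
  simp only [smul_eq_mul] at h
  simp only [h1, h2]
  change _ = ∫ ξ, f ξ * VectorFourier.fourierIntegral _ _ _ _ _
  rw [← h, ← integral_neg_eq_self]
  simp only [neg_neg]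
  rfl

theorem continuous_fourierInv {f : V → ℂ} (hf : Integrable f) : Continuous (𝓕⁻ f) := by
  have h1 : 𝓕⁻ f = fun x => 𝓕 f (-x) := funext fun x => Real.fourierInv_eq_fourier_neg f x
  rw [h1]
  exact (VectorFourier.fourierIntegral_continuous Real.continuous_fourierChar
    (by exact continuous_inner) hf).comp continuous_neg

/-- The inverse Fourier transform on `L²` is given by the Fourier integral on `L¹ ∩ L²`. -/
theorem fourierInv_toLp_ae_eq {f : V → ℂ} (hf : Integrable f) (hf2 : MemLp f 2 volume) :
    ((𝓕⁻ (hf2.toLp f) : LSq V) : V → ℂ) =ᵐ[volume] 𝓕⁻ f := by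
  -- Both sides are tested against smooth compactly supported g. On the left, 𝓕⁻ passes to g by
  -- duality of tempered distributions; on the right, by Fubini.
  refine ae_eq_of_integral_contDiff_smul_eq
    ((Lp.memLp _).locallyIntegrable (by norm_num))
    (continuous_fourierInv hf).locallyIntegrable fun g hg hgc => ?_
  let gc : V → ℂ := fun x => (g x : ℂ)
  have hgc1 : HasCompactSupport gc := hgc.comp_left (g := fun r : ℝ => (r : ℂ)) (by simp)
  have hgc2 : ContDiff ℝ ∞ gc := Complex.ofRealCLM.contDiff.comp hg
  let G := hgc1.toSchwartzMap hgc2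
  have hG : ∀ x, G x = (g x : ℂ) := fun x => rfl
  have h := congrArg (fun T => T G)
    (Lp.fourierInv_toTemperedDistribution_eq (hf2.toLp f : LSq V))
  simp only [TemperedDistribution.fourierInv_apply, Lp.toTemperedDistribution_apply] at h
  have h1 : ∫ x, g x • (𝓕⁻ (hf2.toLp f) : LSq V) x
      = ∫ x, G x • (𝓕⁻ (hf2.toLp f) : LSq V) x := by
    simp [hG]
  rw [h1, ← h]
  have h2 : ∫ x, (𝓕⁻ G : SchwartzMap V ℂ) x • (hf2.toLp f) x = ∫ x, f x * 𝓕⁻ (G : V → ℂ) x := by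
    refine integral_congr_ae ?_
    filter_upwards [MemLp.coeFn_toLp hf2] with x hx
    rw [hx, SchwartzMap.fourierInv_coe, smul_eq_mul, mul_comm]
  rw [h2, ← integral_fourierInv_mul_eq hf (SchwartzMap.integrable (μ := volume) G)]
  refine integral_congr_ae (.of_forall fun x => ?_)
  simp [hG, mul_comm]

theorem fourierInv_eq_zero_imp {f : V → ℂ} (hf : Integrable f) (hf2 : MemLp f 2 volume)
    (h : ∀ x, 𝓕⁻ f x = 0) : f =ᵐ[volume] 0 := by
  have h1 : (𝓕⁻ (hf2.toLp f) : LSq V) = 0 := by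
    rw [Lp.eq_zero_iff_ae_eq_zero]
    filter_upwards [fourierInv_toLp_ae_eq hf hf2] with x hx
    rw [hx, h x]; rfl
  have h2 : hf2.toLp f = (0 : LSq V) := by
    have := congrArg (fun u : LSq V => 𝓕 u) h1
    simp only [FourierTransform.fourier_fourierInv_eq] at this
    rw [this]
    exact (Lp.fourierTransformₗᵢ V ℂ).map_zero
  have := MemLp.coeFn_toLp hf2
  rw [h2] at this
  exact this.symm.trans (Lp.coeFn_zero _ _ _)

end FourierCompatibility

/-! ### Young's inequality for convolutions. -/

section Young

/-- Young's inequality `L² * L¹ → L²` for the Lebesgue integral of nonnegative functions. -/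
theorem lintegral_convolution_sq_le {F G : V → ℝ≥0∞} (hF : AEMeasurable F) (hG : AEMeasurable G) :
    ∫⁻ ξ, (∫⁻ η, F η * G (ξ - η)) ^ (2 : ℝ) ≤ (∫⁻ ξ, G ξ) ^ (2 : ℝ) * ∫⁻ ξ, F ξ ^ (2 : ℝ) := by
  have hGs : ∀ ξ, AEMeasurable (fun η => G (ξ - η)) := fun ξ =>
    hG.comp_quasiMeasurePreserving (quasiMeasurePreserving_sub_left_of_right_invariant volume ξ)
  have key : ∀ ξ, (∫⁻ η, F η * G (ξ - η)) ^ (2 : ℝ)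
      ≤ (∫⁻ η, F η ^ (2 : ℝ) * G (ξ - η)) * ∫⁻ η, G η := by
    intro ξ
    -- Cauchy–Schwarz is applied with G split into two square roots; Tonelli and translation
    -- invariance finish.
    have h1 : ∀ η, F η * G (ξ - η)
        = (F η * G (ξ - η) ^ (1 / 2 : ℝ)) * G (ξ - η) ^ (1 / 2 : ℝ) := by
      intro η
      rw [mul_assoc, ← ENNReal.rpow_add_of_nonneg _ _ (by norm_num) (by norm_num)]
      norm_num
    have h2 := ENNReal.lintegral_mul_le_Lp_mul_Lq volume (p := 2) (q := 2)
      (Real.holderConjugate_iff.2 ⟨by norm_num, by norm_num⟩)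
      (f := fun η => F η * G (ξ - η) ^ (1 / 2 : ℝ)) (g := fun η => G (ξ - η) ^ (1 / 2 : ℝ))
      (hF.mul ((hGs ξ).pow_const _)) ((hGs ξ).pow_const _)
    simp only [Pi.mul_apply] at h2
    simp_rw [← h1] at h2
    refine (ENNReal.rpow_le_rpow h2 (by norm_num : (0:ℝ) ≤ 2)).trans (le_of_eq ?_)
    rw [ENNReal.mul_rpow_of_nonneg _ _ (by norm_num), ← ENNReal.rpow_mul, ← ENNReal.rpow_mul]
    norm_num
    have h3 : ∀ x : ℝ≥0∞, (x ^ (1 / 2 : ℝ)) ^ 2 = x := fun x => by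
      rw [← ENNReal.rpow_natCast, ← ENNReal.rpow_mul]; norm_num
    simp only [mul_pow]
    simp_rw [h3]
    rw [lintegral_sub_left_eq_self]
  calc ∫⁻ ξ, (∫⁻ η, F η * G (ξ - η)) ^ (2 : ℝ)
      ≤ ∫⁻ ξ, (∫⁻ η, F η ^ (2 : ℝ) * G (ξ - η)) * ∫⁻ η, G η := lintegral_mono key
    _ = (∫⁻ ξ, ∫⁻ η, F η ^ (2 : ℝ) * G (ξ - η)) * ∫⁻ η, G η := by
        rw [lintegral_mul_const'']
        exact AEMeasurable.lintegral_prod_right' (f := fun p : V × V => F p.2 ^ (2:ℝ) * G (p.1 - p.2))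
          ((hF.pow_const _).comp_snd.mul
            (hG.comp_quasiMeasurePreserving (quasiMeasurePreserving_sub_of_right_invariant volume volume)))
    _ = (∫⁻ η, ∫⁻ ξ, F η ^ (2 : ℝ) * G (ξ - η)) * ∫⁻ η, G η := by
        rw [lintegral_lintegral_swap]
        exact ((hF.pow_const _).comp_snd.mul
            (hG.comp_quasiMeasurePreserving (quasiMeasurePreserving_sub_of_right_invariant volume volume)))
    _ = (∫⁻ ξ, G ξ) ^ (2 : ℝ) * ∫⁻ ξ, F ξ ^ (2 : ℝ) := by
        have : ∀ η, ∫⁻ ξ, F η ^ (2 : ℝ) * G (ξ - η) = F η ^ (2 : ℝ) * ∫⁻ ξ, G ξ := by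
          intro η
          rw [lintegral_const_mul'', lintegral_sub_right_eq_self]
          exact hG.comp_quasiMeasurePreserving
            (measurePreserving_sub_right volume η).quasiMeasurePreserving
        simp_rw [this]
        rw [lintegral_mul_const'' _ (hF.pow_const _)]
        rw [ENNReal.rpow_two, sq]
        ring

end Young

end QuinticNLS

namespace QuinticNLS

variable {V : Type*} [NormedAddCommGroup V] [InnerProductSpace ℝ V] [FiniteDimensional ℝ V]
  [MeasurableSpace V] [BorelSpace V]

/-! ### Bounded Fourier multipliers on L². -/

section MultiplicationOperators

/-- Multiplication by a bounded function on `L²`. -/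
noncomputable def mulOp {m : V → ℂ} (hm : MemLp m ⊤ volume) : LSq V →L[ℂ] LSq V :=
  (ContinuousLinearMap.mul ℂ ℂ).holderL volume ⊤ 2 2 (hm.toLp m)

theorem coeFn_mulOp {m : V → ℂ} (hm : MemLp m ⊤ volume) (h : LSq V) :
    (mulOp hm h : V → ℂ) =ᵐ[volume] fun ξ => m ξ * h ξ := by
  filter_upwards [(ContinuousLinearMap.mul ℂ ℂ).coeFn_holder (r := 2) (hm.toLp m) h,
    MemLp.coeFn_toLp hm] with ξ h1 h2
  simp only [mulOp, ContinuousLinearMap.holderL_apply_apply]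
  rw [h1, h2]; rfl

theorem norm_le_of_ae_norm_le {f g : LSq V} (h : ∀ᵐ ξ, ‖f ξ‖ ≤ ‖g ξ‖) : ‖f‖ ≤ ‖g‖ :=
  Lp.norm_le_norm_of_ae_le h

theorem norm_mulOp_le {m : V → ℂ} (hm : MemLp m ⊤ volume) (hm1 : ∀ ξ, ‖m ξ‖ ≤ 1) (h : LSq V) :
    ‖mulOp hm h‖ ≤ ‖h‖ := by
  refine norm_le_of_ae_norm_le ?_
  filter_upwards [coeFn_mulOp hm h] with ξ hξ
  rw [hξ, norm_mul]
  exact mul_le_of_le_one_left (norm_nonneg _) (hm1 ξ)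

theorem norm_mulOp_eq {m : V → ℂ} (hm : MemLp m ⊤ volume) (hm1 : ∀ ξ, ‖m ξ‖ = 1) (h : LSq V) :
    ‖mulOp hm h‖ = ‖h‖ := by
  refine le_antisymm (norm_mulOp_le hm (fun ξ => (hm1 ξ).le) h) (norm_le_of_ae_norm_le ?_)
  filter_upwards [coeFn_mulOp hm h] with ξ hξ
  rw [hξ, norm_mul, hm1, one_mul]

end MultiplicationOperators

/-! ### Weighted Fourier spaces: h ∈ L² stands for the function f with f̂ = h / w. -/

variable (V) in
/-- A Sobolev weight whose weighted `L²` space consists of Fourier transforms of an algebra of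
functions contained in `H²`. -/
structure Weight where
  toFun : V → ℝ
  continuous_toFun : Continuous toFun
  lower : ℝ
  lower_pos : 0 < lower
  lower_le : ∀ ξ, lower * (1 + (2 * Real.pi * ‖ξ‖) ^ 2) ≤ toFun ξ
  even : ∀ ξ, toFun (-ξ) = toFun ξ
  add_le : ∀ ξ η, toFun (ξ + η) ≤ 16 * (toFun ξ + toFun η)
  memLp_inv : MemLp (fun ξ => ((toFun ξ : ℂ))⁻¹) 2 volume

namespace Weight

instance : CoeFun (Weight V) fun _ => V → ℝ := ⟨Weight.toFun⟩

variable (w : Weight V)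

theorem lower_le' (ξ : V) : w.lower ≤ w ξ :=
  (le_mul_of_one_le_right w.lower_pos.le (by nlinarith [sq_nonneg (2 * Real.pi * ‖ξ‖)])).trans
    (w.lower_le ξ)

theorem pos (ξ : V) : 0 < w ξ := w.lower_pos.trans_le (w.lower_le' ξ)

theorem ne_zero (ξ : V) : (w ξ : ℂ) ≠ 0 := by exact_mod_cast (w.pos ξ).ne'

theorem continuous : Continuous w := w.continuous_toFun

theorem continuous_inv : Continuous fun ξ => ((w ξ : ℂ))⁻¹ :=
  (Complex.continuous_ofReal.comp w.continuous).inv₀ w.ne_zero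

/-- The norm of `1 / w` in `L²`. -/
noncomputable def invNorm : ℝ := (eLpNorm (fun ξ => ((w ξ : ℂ))⁻¹) 2 volume).toReal

theorem ofReal_invNorm : ENNReal.ofReal w.invNorm = eLpNorm (fun ξ => ((w ξ : ℂ))⁻¹) 2 volume :=
  ENNReal.ofReal_toReal w.memLp_inv.eLpNorm_ne_top

theorem invNorm_nonneg : 0 ≤ w.invNorm := ENNReal.toReal_nonneg

/-- The Fourier transform represented by the element `h` of the weighted space. -/
noncomputable def symbol (h : LSq V) : V → ℂ := fun ξ => h ξ * ((w ξ : ℂ))⁻¹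

theorem memLp_inv_top : MemLp (fun ξ => ((w ξ : ℂ))⁻¹) ⊤ volume := by
  refine memLp_top_of_bound w.continuous_inv.aestronglyMeasurable w.lower⁻¹ (.of_forall fun ξ => ?_)
  rw [norm_inv, Complex.norm_real, Real.norm_of_nonneg (w.pos ξ).le]
  exact inv_anti₀ w.lower_pos (w.lower_le' ξ)

theorem memLp_symbol (h : LSq V) : MemLp (w.symbol h) 2 volume :=
  (w.memLp_inv_top.mul (Lp.memLp h) (r := 2))

theorem integrable_symbol (h : LSq V) : Integrable (w.symbol h) volume :=
  memLp_one_iff_integrable.1 (w.memLp_inv.mul (Lp.memLp h) (r := 1))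

theorem eLpNorm_symbol_one_le (h : LSq V) :
    eLpNorm (w.symbol h) 1 volume ≤ ENNReal.ofReal w.invNorm * ‖h‖ₑ := by
  rw [w.ofReal_invNorm, mul_comm, Lp.enorm_def]
  exact eLpNorm_smul_le_mul_eLpNorm (𝕜 := ℂ) (φ := h)
    w.continuous_inv.aestronglyMeasurable (Lp.memLp h).1

theorem symbol_mul (h : LSq V) (ξ : V) : w.symbol h ξ * w ξ = h ξ := by
  rw [symbol, inv_mul_cancel_right₀ (w.ne_zero ξ)]

theorem memLp_eval (x : V) :
    MemLp (fun ξ => (Real.fourierChar (inner ℝ ξ x) : ℂ) * ((w ξ : ℂ))⁻¹) 2 volume := by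
  refine w.memLp_inv.of_le ?_ (.of_forall fun ξ => by rw [norm_mul, Circle.norm_coe, one_mul])
  exact ((continuous_subtype_val.comp (Real.continuous_fourierChar.comp (by fun_prop))).mul
    w.continuous_inv).aestronglyMeasurable

/-- Evaluation at `x` of the function whose Fourier transform is `w.symbol h`. -/
noncomputable def eval (x : V) : LSq V →L[ℂ] ℂ :=
  (ContinuousLinearMap.mul ℂ ℂ).lpPairing volume 2 2 ((w.memLp_eval x).toLp _)

theorem eval_eq_fourierInv (x : V) (h : LSq V) : w.eval x h = 𝓕⁻ (w.symbol h) x := by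
  rw [eval, ContinuousLinearMap.lpPairing_eq_integral, Real.fourierInv_eq]
  refine integral_congr_ae ?_
  filter_upwards [MemLp.coeFn_toLp (w.memLp_eval x)] with ξ hξ
  rw [hξ, Circle.smul_def, symbol]
  simp only [ContinuousLinearMap.mul_apply', smul_eq_mul]
  ring

/-- Injectivity of the inverse Fourier transform on L¹ ∩ L². Algebraic identities in the weighted
space thereby reduce to pointwise identities between functions. -/
theorem eq_of_eval_eq {h h' : LSq V} (H : ∀ x, w.eval x h = w.eval x h') : h = h' := by
  rw [← sub_eq_zero, Lp.eq_zero_iff_ae_eq_zero]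
  have h0 := fourierInv_eq_zero_imp (w.integrable_symbol (h - h')) (w.memLp_symbol (h - h'))
    fun x => by rw [← eval_eq_fourierInv, map_sub, H, sub_self]
  filter_upwards [h0] with ξ hξ
  rw [← w.symbol_mul, hξ]; simp

section Conjugation

theorem memLp_conjReflect (h : LSq V) : MemLp (fun ξ => starRingEnd ℂ (h (-ξ))) 2 volume := by
  have h1 : MemLp (fun ξ => h (-ξ)) 2 volume :=
    (Lp.memLp h).comp_measurePreserving (Measure.measurePreserving_neg volume)
  exact h1.of_le (Complex.continuous_conj.comp_aestronglyMeasurable h1.1)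
    (.of_forall fun ξ => by simp)

/-- The operation on Fourier transforms corresponding to complex conjugation. -/
noncomputable def conjReflect (h : LSq V) : LSq V := (memLp_conjReflect h).toLp _

theorem coeFn_conjReflect (h : LSq V) :
    (conjReflect h : V → ℂ) =ᵐ[volume] fun ξ => starRingEnd ℂ (h (-ξ)) :=
  MemLp.coeFn_toLp _

theorem norm_conjReflect (h : LSq V) : ‖conjReflect h‖ = ‖h‖ := by
  rw [conjReflect, Lp.norm_toLp, Lp.norm_def]
  congr 1
  rw [← eLpNorm_comp_measurePreserving (Lp.memLp h).1 (Measure.measurePreserving_neg volume)]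
  exact eLpNorm_congr_norm_ae (.of_forall fun ξ => by simp)

theorem eval_conjReflect (x : V) (h : LSq V) :
    w.eval x (conjReflect h) = starRingEnd ℂ (w.eval x h) := by
  rw [eval_eq_fourierInv, eval_eq_fourierInv, Real.fourierInv_eq, Real.fourierInv_eq,
    ← integral_conj, ← integral_neg_eq_self]
  refine integral_congr_ae ?_
  filter_upwards [(Measure.measurePreserving_neg
    (volume : Measure V)).quasiMeasurePreserving.ae (coeFn_conjReflect h)] with ξ hξ
  simp only [symbol, Circle.smul_def, smul_eq_mul, map_mul, map_inv₀, Complex.conj_ofReal]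
  rw [hξ, neg_neg, w.even, inner_neg_left, ← Circle.coe_inv_eq_conj, AddChar.map_neg_eq_inv]

theorem conjReflect_sub (h h' : LSq V) (w : Weight V) :
    conjReflect (h - h') = conjReflect h - conjReflect h' :=
  w.eq_of_eval_eq fun x => by simp [eval_conjReflect]

end Conjugation

/-! ### The algebra property of the weighted space. -/

section Product

open Convolution

/-- Since w(ξ) ≤ 16 (w(η) + w(ξ - η)), the weight falls on one factor at a time; the reflection η ↦
ξ - η brings both terms to the form needed for Young's inequality. -/
theorem enorm_mul_convolution_le {f g : V → ℂ} (hf : AEMeasurable f) (hg : AEMeasurable g) (ξ : V) :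
    ‖(w ξ : ℂ) * (f ⋆[ContinuousLinearMap.mul ℂ ℂ, volume] g) ξ‖ₑ
      ≤ 16 * ((∫⁻ η, ‖f η * w η‖ₑ * ‖g (ξ - η)‖ₑ) + ∫⁻ η, ‖g η * w η‖ₑ * ‖f (ξ - η)‖ₑ) := by
  have hwm : Measurable fun η => (w η : ℂ) :=
    (Complex.continuous_ofReal.comp w.continuous).measurable
  have hgs : AEMeasurable fun η => g (ξ - η) :=
    hg.comp_quasiMeasurePreserving (quasiMeasurePreserving_sub_left_of_right_invariant volume ξ)
  rw [enorm_mul, convolution_def]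
  have h1 : ∀ η, ‖(w ξ : ℂ)‖ₑ * (‖f η‖ₑ * ‖g (ξ - η)‖ₑ)
      ≤ 16 * (‖f η * w η‖ₑ * ‖g (ξ - η)‖ₑ
        + ‖g (ξ - η) * w (ξ - η)‖ₑ * ‖f (ξ - (ξ - η))‖ₑ) := by
    intro η
    have hw : ‖(w ξ : ℂ)‖ₑ ≤ 16 * (‖(w η : ℂ)‖ₑ + ‖(w (ξ - η) : ℂ)‖ₑ) := by
      simp only [← ofReal_norm, Complex.norm_real, Real.norm_of_nonneg (w.pos _).le]
      rw [← ENNReal.ofReal_add (w.pos _).le (w.pos _).le,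
        show (16 : ℝ≥0∞) = ENNReal.ofReal 16 by norm_num, ← ENNReal.ofReal_mul (by norm_num)]
      refine ENNReal.ofReal_le_ofReal ?_
      simpa using w.add_le η (ξ - η)
    rw [sub_sub_cancel, enorm_mul, enorm_mul]
    calc _ ≤ 16 * (‖(w η : ℂ)‖ₑ + ‖(w (ξ - η) : ℂ)‖ₑ) * (‖f η‖ₑ * ‖g (ξ - η)‖ₑ) := by gcongr
      _ = _ := by ring
  calc ‖(w ξ : ℂ)‖ₑ * ‖∫ η, ContinuousLinearMap.mul ℂ ℂ (f η) (g (ξ - η))‖ₑ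
      ≤ ‖(w ξ : ℂ)‖ₑ * ∫⁻ η, ‖f η‖ₑ * ‖g (ξ - η)‖ₑ := by
        gcongr
        refine (enorm_integral_le_lintegral_enorm _).trans (le_of_eq ?_)
        simp
    _ = ∫⁻ η, ‖(w ξ : ℂ)‖ₑ * (‖f η‖ₑ * ‖g (ξ - η)‖ₑ) :=
        (lintegral_const_mul' _ _ enorm_ne_top).symm
    _ ≤ _ := lintegral_mono h1
    _ = _ := by
      rw [lintegral_const_mul' _ _ (by norm_num), lintegral_add_left'
        (by exact (hf.mul hwm.aemeasurable).enorm.mul hgs.enorm),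
        lintegral_sub_left_eq_self (fun η => ‖g η * w η‖ₑ * ‖f (ξ - η)‖ₑ) ξ]

theorem eLpNorm_lintegral_convolution_le (h : LSq V) (h' : LSq V) :
    eLpNorm (fun ξ => ∫⁻ η, ‖w.symbol h η * w η‖ₑ * ‖w.symbol h' (ξ - η)‖ₑ) 2 volume
      ≤ ENNReal.ofReal w.invNorm * (‖h‖ₑ * ‖h'‖ₑ) := by
  have hy := lintegral_convolution_sq_le (Lp.aestronglyMeasurable h).enorm
    (w.integrable_symbol h').1.enorm
  simp_rw [w.symbol_mul]
  rw [eLpNorm_eq_lintegral_rpow_enorm_toReal (by norm_num) (by norm_num)]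
  simp only [enorm_eq_self, ENNReal.toReal_ofNat]
  refine (ENNReal.rpow_le_rpow hy (by norm_num)).trans ?_
  rw [ENNReal.mul_rpow_of_nonneg _ _ (by norm_num), ← ENNReal.rpow_mul]
  have h2 : (∫⁻ ξ, ‖h ξ‖ₑ ^ (2 : ℝ)) ^ (1 / 2 : ℝ) = ‖h‖ₑ := by
    rw [Lp.enorm_def, eLpNorm_eq_lintegral_rpow_enorm_toReal (by norm_num) (by norm_num)]
    simp
  have h3 := w.eLpNorm_symbol_one_le h'
  rw [eLpNorm_one_eq_lintegral_enorm] at h3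
  rw [h2]
  norm_num
  calc _ ≤ (ENNReal.ofReal w.invNorm * ‖h'‖ₑ) * ‖h‖ₑ := by gcongr
    _ = _ := by ring

theorem memLp_convolution (h₁ h₂ : LSq V) :
    MemLp (fun ξ => (w ξ : ℂ) *
      (w.symbol h₁ ⋆[ContinuousLinearMap.mul ℂ ℂ, volume] w.symbol h₂) ξ) 2 volume ∧
    eLpNorm (fun ξ => (w ξ : ℂ) *
      (w.symbol h₁ ⋆[ContinuousLinearMap.mul ℂ ℂ, volume] w.symbol h₂) ξ) 2 volume
        ≤ ENNReal.ofReal (32 * w.invNorm) * (‖h₁‖ₑ * ‖h₂‖ₑ) := by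
  have hm : ∀ h h' : LSq V, AEStronglyMeasurable
      (fun ξ => ∫⁻ η, ‖w.symbol h η * w η‖ₑ * ‖w.symbol h' (ξ - η)‖ₑ) volume := by
    intro h h'
    simp_rw [w.symbol_mul]
    exact (AEMeasurable.lintegral_prod_right'
      (f := fun p : V × V => ‖h p.2‖ₑ * ‖w.symbol h' (p.1 - p.2)‖ₑ)
      ((Lp.aestronglyMeasurable h).enorm.comp_snd.mul
        ((w.integrable_symbol h').1.enorm.comp_quasiMeasurePreserving
          (quasiMeasurePreserving_sub_of_right_invariant volume volume)))).aestronglyMeasurable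
  have hle : eLpNorm (fun ξ => (w ξ : ℂ) *
      (w.symbol h₁ ⋆[ContinuousLinearMap.mul ℂ ℂ, volume] w.symbol h₂) ξ) 2 volume
        ≤ ENNReal.ofReal (32 * w.invNorm) * (‖h₁‖ₑ * ‖h₂‖ₑ) := by
    refine (eLpNorm_le_nnreal_smul_eLpNorm_of_ae_le_mul' (c := 16) (g := (fun ξ =>
      ∫⁻ η, ‖w.symbol h₁ η * w η‖ₑ * ‖w.symbol h₂ (ξ - η)‖ₑ) +
      fun ξ => ∫⁻ η, ‖w.symbol h₂ η * w η‖ₑ * ‖w.symbol h₁ (ξ - η)‖ₑ)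
      (.of_forall fun ξ => ?_) 2).trans ?_
    · exact (w.enorm_mul_convolution_le (w.integrable_symbol h₁).1.aemeasurable
        (w.integrable_symbol h₂).1.aemeasurable ξ).trans (le_of_eq (by simp))
    · rw [ENNReal.smul_def, smul_eq_mul]
      calc _ ≤ ((16 : NNReal) : ℝ≥0∞) * (ENNReal.ofReal w.invNorm * (‖h₁‖ₑ * ‖h₂‖ₑ)
              + ENNReal.ofReal w.invNorm * (‖h₂‖ₑ * ‖h₁‖ₑ)) := by
            gcongr
            exact (eLpNorm_add_le (hm _ _) (hm _ _) (by norm_num)).trans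
              (add_le_add (w.eLpNorm_lintegral_convolution_le _ _)
                (w.eLpNorm_lintegral_convolution_le _ _))
        _ = _ := by
            rw [ENNReal.ofReal_mul (by norm_num)]
            norm_num
            ring
  refine ⟨⟨?_, hle.trans_lt (ENNReal.mul_lt_top ENNReal.ofReal_lt_top
    (ENNReal.mul_lt_top enorm_lt_top enorm_lt_top))⟩, hle⟩
  exact (Complex.continuous_ofReal.comp w.continuous).aestronglyMeasurable.mul
    ((w.integrable_symbol h₁).integrable_convolution (ContinuousLinearMap.mul ℂ ℂ)
      (w.integrable_symbol h₂)).1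

/-- The operation on weighted Fourier transforms corresponding to the product of functions. -/
noncomputable def prod (h₁ h₂ : LSq V) : LSq V := (w.memLp_convolution h₁ h₂).1.toLp _

theorem norm_prod_le (h₁ h₂ : LSq V) : ‖w.prod h₁ h₂‖ ≤ 32 * w.invNorm * ‖h₁‖ * ‖h₂‖ := by
  rw [prod, Lp.norm_toLp]
  refine ENNReal.toReal_le_of_le_ofReal (by have := w.invNorm_nonneg; positivity)
    ((w.memLp_convolution h₁ h₂).2.trans (le_of_eq ?_))
  rw [mul_assoc (32 * w.invNorm), ENNReal.ofReal_mul (p := 32 * w.invNorm)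
    (by have := w.invNorm_nonneg; positivity),
    ENNReal.ofReal_mul (norm_nonneg _), ofReal_norm, ofReal_norm]

theorem symbol_prod (h₁ h₂ : LSq V) :
    w.symbol (w.prod h₁ h₂) =ᵐ[volume]
      w.symbol h₁ ⋆[ContinuousLinearMap.mul ℂ ℂ, volume] w.symbol h₂ := by
  filter_upwards [MemLp.coeFn_toLp (w.memLp_convolution h₁ h₂).1] with ξ hξ
  rw [symbol, prod, hξ, mul_comm, inv_mul_cancel_left₀ (w.ne_zero ξ)]

theorem eval_prod (x : V) (h₁ h₂ : LSq V) :
    w.eval x (w.prod h₁ h₂) = w.eval x h₁ * w.eval x h₂ := by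
  simp only [eval_eq_fourierInv, Real.fourierInv_eq_fourier_neg]
  rw [← Real.fourier_mul_convolution_eq (w.integrable_symbol h₁) (w.integrable_symbol h₂)]
  rw [Real.fourier_eq, Real.fourier_eq]
  refine integral_congr_ae ?_
  filter_upwards [w.symbol_prod h₁ h₂] with ξ hξ
  rw [hξ]

/-- `Weight.prod` as a continuous bilinear map. -/
noncomputable def prodL : LSq V →L[ℂ] LSq V →L[ℂ] LSq V :=
  LinearMap.mkContinuous₂
    (LinearMap.mk₂ ℂ w.prod
      (fun _ _ _ => w.eq_of_eval_eq fun x => by simp only [eval_prod, map_add]; ring)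
      (fun _ _ _ => w.eq_of_eval_eq fun x => by simp only [eval_prod, map_smul, smul_eq_mul]; ring)
      (fun _ _ _ => w.eq_of_eval_eq fun x => by simp only [eval_prod, map_add]; ring)
      (fun _ _ _ => w.eq_of_eval_eq fun x => by simp only [eval_prod, map_smul, smul_eq_mul]; ring))
    (32 * w.invNorm) w.norm_prod_le

theorem prodL_apply (h₁ h₂ : LSq V) : w.prodL h₁ h₂ = w.prod h₁ h₂ := rfl

end Product

end Weight

end QuinticNLS

namespace QuinticNLS

variable {V : Type*} [NormedAddCommGroup V] [InnerProductSpace ℝ V] [FiniteDimensional ℝ V]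
  [MeasurableSpace V] [BorelSpace V]

namespace Weight

variable (w : Weight V)

/-! ### The quintic nonlinearity and its Lipschitz bound. -/

section Nonlinearity

/-- The quintic nonlinearity `|u|⁴u` on the Fourier side. -/
noncomputable def nonlin (h : LSq V) : LSq V :=
  w.prod (w.prod (w.prod (w.prod h (conjReflect h)) h) (conjReflect h)) h

theorem eval_nonlin (x : V) (h : LSq V) :
    w.eval x (w.nonlin h) = (‖w.eval x h‖ : ℂ) ^ 4 * w.eval x h := by
  simp only [nonlin, eval_prod, eval_conjReflect]
  have h1 := Complex.mul_conj' (w.eval x h)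
  linear_combination ((starRingEnd ℂ (w.eval x h) * w.eval x h + (‖w.eval x h‖ : ℂ) ^ 2)
    * w.eval x h) * h1

/-- Telescoping ab - a'b' = (a - a')b + a'(b - b'). Sizes and difference are bounded together so
that the estimate can be iterated along the nested products of `nonlin`. -/
theorem norm_prod_sub_le {K A D R δ : ℝ} {a a' b b' : LSq V} (hK : 32 * w.invNorm ≤ K)
    (ha : ‖a‖ ≤ A) (ha' : ‖a'‖ ≤ A) (hD : ‖a - a'‖ ≤ D) (hb : ‖b‖ ≤ R) (hb' : ‖b'‖ ≤ R)
    (hδ : ‖b - b'‖ ≤ δ) :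
    ‖w.prod a b‖ ≤ K * A * R ∧ ‖w.prod a' b'‖ ≤ K * A * R ∧
      ‖w.prod a b - w.prod a' b'‖ ≤ K * (D * R + A * δ) := by
  have hK0 : 0 ≤ K := (mul_nonneg (by norm_num) w.invNorm_nonneg).trans hK
  have hA := (norm_nonneg a).trans ha
  have hD0 := (norm_nonneg _).trans hD
  have hle : ∀ {x y : LSq V} {X Y : ℝ}, ‖x‖ ≤ X → ‖y‖ ≤ Y → ‖w.prod x y‖ ≤ K * X * Y := by
    intro x y X Y hx hy
    have := (norm_nonneg x).trans hx
    have := w.invNorm_nonneg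
    exact (w.norm_prod_le x y).trans (by gcongr)
  refine ⟨hle ha hb, hle ha' hb', ?_⟩
  have : w.prod a b - w.prod a' b' = w.prod (a - a') b + w.prod a' (b - b') := by
    simp only [← prodL_apply, map_sub, sub_apply]; abel
  rw [this]
  refine (norm_add_le _ _).trans ((add_le_add (hle hD hb) (hle ha' hδ)).trans (le_of_eq (by ring)))

/-- Four products give K⁴, and each of the five factors contributes one difference. -/
theorem norm_nonlin_sub_le {K R : ℝ} {h h' : LSq V} (hK : 32 * w.invNorm ≤ K)
    (hh : ‖h‖ ≤ R) (hh' : ‖h'‖ ≤ R) :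
    ‖w.nonlin h - w.nonlin h'‖ ≤ 5 * K ^ 4 * R ^ 4 * ‖h - h'‖ := by
  have hc : ‖conjReflect h‖ ≤ R := (norm_conjReflect h).le.trans hh
  have hc' : ‖conjReflect h'‖ ≤ R := (norm_conjReflect h').le.trans hh'
  have hcd : ‖conjReflect h - conjReflect h'‖ ≤ ‖h - h'‖ := by
    rw [← conjReflect_sub h h' w, norm_conjReflect]
  obtain ⟨a1, a2, a3⟩ := w.norm_prod_sub_le hK hh hh' le_rfl hc hc' hcd
  obtain ⟨b1, b2, b3⟩ := w.norm_prod_sub_le hK a1 a2 a3 hh hh' le_rfl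
  obtain ⟨c1, c2, c3⟩ := w.norm_prod_sub_le hK b1 b2 b3 hc hc' hcd
  obtain ⟨-, -, d3⟩ := w.norm_prod_sub_le hK c1 c2 c3 hh hh' le_rfl
  exact d3.trans (le_of_eq (by ring))

theorem continuous_conjReflect (w : Weight V) : Continuous (conjReflect : LSq V → LSq V) :=
  (Isometry.of_dist_eq fun h h' => by
    rw [dist_eq_norm, dist_eq_norm, ← conjReflect_sub h h' w, norm_conjReflect]).continuous

theorem continuous_prod {X : Type*} [TopologicalSpace X] {f g : X → LSq V} (hf : Continuous f)
    (hg : Continuous g) : Continuous fun x => w.prod (f x) (g x) :=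
  (w.prodL.continuous.comp hf).clm_apply hg

theorem continuous_nonlin : Continuous w.nonlin := by
  have hc := w.continuous_conjReflect
  exact w.continuous_prod (w.continuous_prod (w.continuous_prod (w.continuous_prod
    continuous_id hc) continuous_id) hc) continuous_id

end Nonlinearity

end Weight

/-! ### The linear group, an isometric and strongly continuous family. -/

section Propagator

/-- The symbol of `Δ²`. -/
noncomputable def bilaplaceSymbol (ξ : V) : ℝ := (2 * Real.pi * ‖ξ‖) ^ 4

theorem continuous_bilaplaceSymbol : Continuous (bilaplaceSymbol : V → ℝ) := by
  unfold bilaplaceSymbol; fun_prop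

/-- The symbol of the propagator `e^{iτΔ²}`. -/
noncomputable def phase (τ : ℝ) (ξ : V) : ℂ := Complex.exp ((τ * bilaplaceSymbol ξ : ℝ) * Complex.I)

theorem norm_phase (τ : ℝ) (ξ : V) : ‖phase τ ξ‖ = 1 := Complex.norm_exp_ofReal_mul_I _

theorem continuous_phase : Continuous fun p : ℝ × V => phase p.1 p.2 := by
  have := continuous_bilaplaceSymbol (V := V)
  unfold phase; fun_prop

theorem phase_neg_mul_phase (τ : ℝ) (ξ : V) : phase (-τ) ξ * phase τ ξ = 1 := by
  rw [phase, phase, ← Complex.exp_add]; simp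

theorem phase_zero (ξ : V) : phase 0 ξ = 1 := by simp [phase]

theorem memLp_phase (τ : ℝ) : MemLp (phase τ : V → ℂ) ⊤ volume :=
  memLp_top_of_bound (continuous_phase.comp (by fun_prop : Continuous fun ξ : V => (τ, ξ))
    ).aestronglyMeasurable 1 (.of_forall fun ξ => (norm_phase τ ξ).le)

/-- The propagator `e^{iτΔ²}` on the Fourier side. -/
noncomputable def propagator (τ : ℝ) : LSq V →L[ℂ] LSq V := mulOp (memLp_phase τ)

theorem coeFn_propagator (τ : ℝ) (h : LSq V) :
    (propagator τ h : V → ℂ) =ᵐ[volume] fun ξ => phase τ ξ * h ξ := coeFn_mulOp _ _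

theorem norm_propagator (τ : ℝ) (h : LSq V) : ‖propagator τ h‖ = ‖h‖ :=
  norm_mulOp_eq _ (norm_phase τ) h

theorem propagator_zero (h : LSq V) : propagator 0 h = h := by
  refine Lp.ext ?_
  filter_upwards [coeFn_propagator 0 h] with ξ hξ
  rw [hξ, phase_zero, one_mul]

theorem tendsto_zero_of_dominated {ι : Type*} {l : Filter ι} [l.IsCountablyGenerated]
    {f : ι → LSq V} {F : ι → V → ℂ} {g : LSq V} (hF : ∀ i, (f i : V → ℂ) =ᵐ[volume] F i)
    (hb : ∀ i, ∀ᵐ ξ, ‖F i ξ‖ ≤ ‖g ξ‖) (hl : ∀ᵐ ξ, Tendsto (fun i => F i ξ) l (𝓝 0)) : Tendsto f l (𝓝 0) := by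
  have h1 : ∀ u : LSq V, ‖u‖ₑ = (∫⁻ ξ, ‖u ξ‖ₑ ^ (2 : ℝ)) ^ (1 / 2 : ℝ) := fun u => by
    rw [Lp.enorm_def, eLpNorm_eq_lintegral_rpow_enorm_toReal (by norm_num) (by norm_num)]
    simp
  have hg : ∫⁻ ξ, ‖g ξ‖ₑ ^ (2 : ℝ) ≠ ⊤ := by
    have := h1 g ▸ (enorm_ne_top (x := g))
    contrapose! this
    rw [this]; norm_num
  have h2 : Tendsto (fun i => ∫⁻ ξ, ‖F i ξ‖ₑ ^ (2 : ℝ)) l (𝓝 (∫⁻ _ : V, 0)) := by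
    refine tendsto_lintegral_filter_of_dominated_convergence' (fun ξ => ‖g ξ‖ₑ ^ (2 : ℝ))
      (.of_forall fun i =>
        ((Lp.aestronglyMeasurable (f i)).congr (hF i)).enorm.pow_const _)
      (.of_forall fun i => ?_) hg ?_
    · filter_upwards [hb i] with ξ hξ
      gcongr
      exact enorm_le_iff_norm_le.2 hξ
    · filter_upwards [hl] with ξ hξ
      have := (ENNReal.continuous_rpow_const (y := 2)).tendsto 0 |>.comp
        ((continuous_enorm.tendsto (0 : ℂ)).comp hξ |>.trans (by simp))
      simpa [Function.comp_def] using this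
  rw [tendsto_zero_iff_enorm_tendsto_zero]
  have h3 : ∀ i, ‖f i‖ₑ = (∫⁻ ξ, ‖F i ξ‖ₑ ^ (2 : ℝ)) ^ (1 / 2 : ℝ) := fun i => by
    rw [h1, lintegral_congr_ae]
    filter_upwards [hF i] with ξ hξ
    rw [hξ]
  simp_rw [h3]
  have := ((ENNReal.continuous_rpow_const (y := 1 / 2)).tendsto _).comp h2
  simpa [Function.comp_def] using this

/-- The symbol of Δ² is unbounded, so only strong continuity can be expected; it follows by
dominated convergence with majorant 2|h|. -/
theorem continuous_propagator_apply (h : LSq V) : Continuous fun τ => propagator τ h := by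
  rw [continuous_iff_continuousAt]
  intro τ₀
  have h0 : Tendsto (fun τ => propagator τ h - propagator τ₀ h) (𝓝 τ₀) (𝓝 0) := by
    refine tendsto_zero_of_dominated (g := (2 : ℂ) • h)
      (F := fun τ ξ => (phase τ ξ - phase τ₀ ξ) * h ξ) (fun τ => ?_) (fun τ => ?_)
      (.of_forall fun ξ => ?_)
    · filter_upwards [Lp.coeFn_sub (propagator τ h) (propagator τ₀ h), coeFn_propagator τ h,
        coeFn_propagator τ₀ h] with ξ h1 h2 h3
      rw [h1, Pi.sub_apply, h2, h3, ← sub_mul]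
    · filter_upwards [Lp.coeFn_smul (2 : ℂ) h] with ξ h4
      rw [h4, norm_mul, Pi.smul_apply, norm_smul]
      gcongr
      refine (norm_sub_le _ _).trans ?_
      rw [norm_phase, norm_phase]; norm_num
    · have h5 : Continuous fun τ : ℝ => (phase τ ξ - phase τ₀ ξ) * h ξ :=
        ((continuous_phase.comp (by fun_prop : Continuous fun τ : ℝ => (τ, ξ))).sub
          continuous_const).mul continuous_const
      simpa using h5.tendsto τ₀
  have := h0.add_const (propagator τ₀ h)
  simpa [ContinuousAt] using this

theorem continuous_propagator {X : Type*} [TopologicalSpace X] {f : X → ℝ} {g : X → LSq V}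
    (hf : Continuous f) (hg : Continuous g) : Continuous fun x => propagator (f x) (g x) := by
  rw [continuous_iff_continuousAt]
  intro x₀
  have h1 : Tendsto (fun x => propagator (f x) (g x - g x₀)) (𝓝 x₀) (𝓝 0) := by
    rw [tendsto_zero_iff_norm_tendsto_zero]
    simp_rw [norm_propagator]
    have := (hg.sub (continuous_const (y := g x₀))).norm.tendsto x₀
    simpa using this
  have h2 := ((continuous_propagator_apply (g x₀)).comp hf).tendsto x₀
  have := h1.add h2
  simpa [ContinuousAt, map_sub] using this

end Propagator

/-! ### The interaction representation and the comparison of weights. -/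

namespace Weight

variable (w : Weight V)

/-- The nonlinearity in the interaction representation. -/
noncomputable def interaction (τ : ℝ) (h : LSq V) : LSq V :=
  propagator (-τ) (w.nonlin (propagator τ h))

theorem continuous_interaction {X : Type*} [TopologicalSpace X] {f : X → ℝ} {g : X → LSq V}
    (hf : Continuous f) (hg : Continuous g) : Continuous fun x => w.interaction (f x) (g x) :=
  continuous_propagator hf.neg (w.continuous_nonlin.comp (continuous_propagator hf hg))

theorem norm_interaction_sub_le {K R τ : ℝ} {h h' : LSq V} (hK : 32 * w.invNorm ≤ K)
    (hh : ‖h‖ ≤ R) (hh' : ‖h'‖ ≤ R) :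
    ‖w.interaction τ h - w.interaction τ h'‖ ≤ 5 * K ^ 4 * R ^ 4 * ‖h - h'‖ := by
  rw [interaction, interaction, ← map_sub, norm_propagator]
  refine (w.norm_nonlin_sub_le hK (R := R)
    ((norm_propagator τ h).le.trans hh) ((norm_propagator τ h').le.trans hh')).trans ?_
  rw [← map_sub, norm_propagator]

theorem interaction_zero (h : LSq V) : w.interaction 0 h = w.nonlin h := by
  rw [interaction, neg_zero, propagator_zero, propagator_zero]

section Comparison

variable {w} {w' : Weight V}

theorem memLp_ratio (hw : ∀ ξ, w ξ ≤ w' ξ) :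
    MemLp (fun ξ => (w ξ : ℂ) * ((w' ξ : ℂ))⁻¹) ⊤ volume := by
  refine memLp_top_of_bound ((Complex.continuous_ofReal.comp w.continuous).mul
    w'.continuous_inv).aestronglyMeasurable 1 (.of_forall fun ξ => ?_)
  rw [norm_mul, norm_inv, Complex.norm_real, Complex.norm_real, Real.norm_of_nonneg (w.pos ξ).le,
    Real.norm_of_nonneg (w'.pos ξ).le, ← div_eq_mul_inv]
  exact div_le_one_of_le₀ (hw ξ) (w'.pos ξ).le

/-- The inclusion of the weighted space of `w'` into that of a smaller weight `w`. -/
noncomputable def incl (hw : ∀ ξ, w ξ ≤ w' ξ) : LSq V →L[ℂ] LSq V := mulOp (memLp_ratio hw)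

variable (hw : ∀ ξ, w ξ ≤ w' ξ)

theorem norm_incl_le (h : LSq V) : ‖incl hw h‖ ≤ ‖h‖ := by
  refine norm_mulOp_le _ (fun ξ => ?_) h
  rw [norm_mul, norm_inv, Complex.norm_real, Complex.norm_real, Real.norm_of_nonneg (w.pos ξ).le,
    Real.norm_of_nonneg (w'.pos ξ).le, ← div_eq_mul_inv]
  exact div_le_one_of_le₀ (hw ξ) (w'.pos ξ).le

theorem symbol_incl (h : LSq V) : w.symbol (incl hw h) =ᵐ[volume] w'.symbol h := by
  filter_upwards [coeFn_mulOp (memLp_ratio hw) h] with ξ hξ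
  rw [symbol, symbol, incl, hξ]
  have := w.ne_zero ξ
  field_simp

theorem eval_incl (x : V) (h : LSq V) : w.eval x (incl hw h) = w'.eval x h := by
  rw [eval_eq_fourierInv, eval_eq_fourierInv, Real.fourierInv_eq, Real.fourierInv_eq]
  refine integral_congr_ae ?_
  filter_upwards [symbol_incl hw h] with ξ hξ
  rw [hξ]

theorem nonlin_incl (h : LSq V) : w.nonlin (incl hw h) = incl hw (w'.nonlin h) :=
  w.eq_of_eval_eq fun x => by simp only [eval_nonlin, eval_incl]

theorem propagator_incl (τ : ℝ) (h : LSq V) :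
    propagator τ (incl hw h) = incl hw (propagator τ h) := by
  refine Lp.ext ?_
  filter_upwards [coeFn_propagator τ (incl hw h), coeFn_mulOp (memLp_ratio hw) h,
    coeFn_mulOp (memLp_ratio hw) (propagator τ h), coeFn_propagator τ h] with ξ h1 h2 h3 h4
  rw [h1, incl, h2, h3, h4]; ring

/-- `incl` changes the representative of a function but not the function itself. A path built for
one weight thus serves as an approximate solution for every smaller weight. -/
theorem interaction_incl (τ : ℝ) (h : LSq V) :
    w.interaction τ (incl hw h) = incl hw (w'.interaction τ h) := by
  rw [interaction, interaction, propagator_incl, nonlin_incl, propagator_incl]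

end Comparison

end Weight

end QuinticNLS

namespace QuinticNLS

/-! ### Approximate solutions of integral equations. -/

section Shadowing

variable {X : Type*} [NormedAddCommGroup X] [NormedSpace ℝ X] [CompleteSpace X]

theorem integral_mul_exp_le {L C t : ℝ} (hC : 0 ≤ C) :
    Real.exp (-(2 * L * t)) * ∫ σ in (0 : ℝ)..t, L * (Real.exp (2 * L * σ) * C) ≤ C / 2 := by
  have h1 : ∫ σ in (0 : ℝ)..t, L * (Real.exp (2 * L * σ) * C)
      = Real.exp (2 * L * t) * C / 2 - Real.exp (2 * L * 0) * C / 2 := by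
    refine intervalIntegral.integral_eq_sub_of_hasDerivAt
      (f := fun σ => Real.exp (2 * L * σ) * C / 2) (fun σ _ => ?_)
      (by apply Continuous.intervalIntegrable; fun_prop)
    have h2 : HasDerivAt (fun σ : ℝ => 2 * L * σ) (2 * L) σ := by
      simpa using (hasDerivAt_id σ).const_mul (2 * L)
    have h3 := (h2.exp.mul_const C).div_const 2
    exact h3.congr_deriv (by ring)
  have h4 : Real.exp (-(2 * L * t)) * Real.exp (2 * L * t) = 1 := by
    rw [← Real.exp_add]; simp
  rw [h1]
  have h5 := (Real.exp_pos (-(2 * L * t))).le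
  have h6 : Real.exp (-(2 * L * t)) * (Real.exp (2 * L * t) * C / 2 - Real.exp (2 * L * 0) * C / 2)
      = (Real.exp (-(2 * L * t)) * Real.exp (2 * L * t)) * C / 2
        - Real.exp (-(2 * L * t)) * C / 2 := by simp; ring
  rw [h6, h4]
  have : 0 ≤ Real.exp (-(2 * L * t)) * C / 2 := by positivity
  linarith

/-- An approximate solution of an integral equation with locally Lipschitz nonlinearity is shadowed
by a true solution. -/
theorem exists_solution_near {F : ℝ → X → X} (hF : Continuous fun p : ℝ × X => F p.1 p.2)
    {W : ℝ → X} (hW : Continuous W) {T L r ε : ℝ} (hT : 0 ≤ T) (hL : 0 < L) (hε : 0 ≤ ε)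
    (hr : 2 * ε * Real.exp (2 * L * T) ≤ r)
    (hLip : ∀ t ∈ Set.Icc 0 T, ∀ x y, ‖x - W t‖ ≤ r → ‖y - W t‖ ≤ r →
      ‖F t x - F t y‖ ≤ L * ‖x - y‖) {x₀ : X}
    (hdef : ∀ t ∈ Set.Icc 0 T, ‖x₀ + (∫ σ in (0 : ℝ)..t, F σ (W σ)) - W t‖ ≤ ε) :
    ∃ v : ℝ → X, Continuous v ∧
      ∀ t ∈ Set.Icc 0 T, v t = x₀ + (∫ σ in (0 : ℝ)..t, F σ (v σ)) ∧ ‖v t - W t‖ ≤ r := by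
  -- The unknown is y = e^{-2Lσ}(v - W): in this exponentially weighted sup norm the integral
  -- operator has Lipschitz constant L / 2L = 1/2, however long the interval. Clamping by `projIcc`
  -- extends the path continuously to ℝ.
  let p : C(Set.Icc 0 T, X) → ℝ → X := fun y σ =>
    W σ + Real.exp (2 * L * σ) • y (Set.projIcc 0 T hT σ)
  have hp : ∀ y, Continuous (p y) := fun y => by
    have := continuous_projIcc (h := hT)
    fun_prop
  have hFp : ∀ y, Continuous fun σ => F σ (p y σ) := fun y =>
    hF.comp (continuous_id.prodMk (hp y))
  let Ψ : C(Set.Icc 0 T, X) → C(Set.Icc 0 T, X) := fun y =>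
    ⟨fun t => Real.exp (-(2 * L * t)) • (x₀ + (∫ σ in (0 : ℝ)..t, F σ (p y σ)) - W t), by
      have h1 : Continuous fun t : ℝ => ∫ σ in (0 : ℝ)..t, F σ (p y σ) :=
        intervalIntegral.continuous_primitive (fun a b => (hFp y).intervalIntegrable a b) 0
      have h2 : Continuous fun t : ℝ => Real.exp (-(2 * L * t)) •
          (x₀ + (∫ σ in (0 : ℝ)..t, F σ (p y σ)) - W t) := by fun_prop
      exact h2.comp continuous_subtype_val⟩
  have hpW : ∀ y ∈ Metric.closedBall (0 : C(Set.Icc 0 T, X)) (2 * ε), ∀ σ ∈ Set.Icc 0 T,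
      ‖p y σ - W σ‖ ≤ r := by
    intro y hy σ hσ
    rw [mem_closedBall_zero_iff] at hy
    simp only [p, add_sub_cancel_left, norm_smul, Real.norm_of_nonneg (Real.exp_pos _).le]
    refine le_trans ?_ hr
    rw [mul_comm (2 * ε)]
    gcongr
    · exact hσ.2
    · exact (y.norm_coe_le_norm _).trans hy
  have hdiff : ∀ y ∈ Metric.closedBall (0 : C(Set.Icc 0 T, X)) (2 * ε),
      ∀ z ∈ Metric.closedBall (0 : C(Set.Icc 0 T, X)) (2 * ε),
      ‖Ψ y - Ψ z‖ ≤ ‖y - z‖ / 2 := by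
    intro y hy z hz
    rw [ContinuousMap.norm_le _ (by positivity)]
    intro t
    have h1 : (Ψ y - Ψ z) t = Real.exp (-(2 * L * t)) •
        ∫ σ in (0 : ℝ)..t, (F σ (p y σ) - F σ (p z σ)) := by
      rw [intervalIntegral.integral_sub ((hFp y).intervalIntegrable _ _)
        ((hFp z).intervalIntegrable _ _)]
      simp only [Ψ, ContinuousMap.sub_apply, ContinuousMap.coe_mk, ← smul_sub]
      congr 1; abel
    rw [h1, norm_smul, Real.norm_of_nonneg (Real.exp_pos _).le]
    refine le_trans ?_ (integral_mul_exp_le (L := L) (t := t) (norm_nonneg (y - z)))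
    gcongr
    refine intervalIntegral.norm_integral_le_of_norm_le t.2.1 (.of_forall fun σ hσ => ?_)
      (by apply Continuous.intervalIntegrable; fun_prop)
    have hσ' : σ ∈ Set.Icc 0 T := ⟨hσ.1.le, hσ.2.trans t.2.2⟩
    refine (hLip σ hσ' _ _ (hpW y hy σ hσ') (hpW z hz σ hσ')).trans ?_
    have h2 : p y σ - p z σ = Real.exp (2 * L * σ) • (y - z) (Set.projIcc 0 T hT σ) := by
      simp only [p, add_sub_add_left_eq_sub, ContinuousMap.sub_apply, smul_sub]
    rw [h2, norm_smul, Real.norm_of_nonneg (Real.exp_pos _).le]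
    gcongr
    exact (y - z).norm_coe_le_norm _
  have h0 : ‖Ψ 0‖ ≤ ε := by
    rw [ContinuousMap.norm_le _ hε]
    intro t
    simp only [Ψ, p, ContinuousMap.coe_mk, ContinuousMap.zero_apply, smul_zero, add_zero,
      norm_smul, Real.norm_of_nonneg (Real.exp_pos _).le]
    refine (mul_le_of_le_one_left (norm_nonneg _) ?_).trans (hdef t t.2)
    rw [Real.exp_le_one_iff]
    have := t.2.1
    simp only [Left.neg_nonpos_iff]; positivity
  have hmaps : Set.MapsTo Ψ (Metric.closedBall 0 (2 * ε)) (Metric.closedBall 0 (2 * ε)) := by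
    intro y hy
    -- Here ‖Ψ y‖ ≤ ‖Ψ 0‖ + ‖y‖/2 ≤ ε + ε, which explains the radius 2ε.
    have h1 := hdiff y hy 0 (by simp [hε])
    rw [mem_closedBall_zero_iff] at hy ⊢
    have h2 := norm_add_le (Ψ y - Ψ 0) (Ψ 0)
    rw [sub_add_cancel] at h2
    rw [sub_zero] at h1
    linarith
  have hcon : ContractingWith (1 / 2) (hmaps.restrict Ψ _ _) := by
    refine ⟨by norm_num [← NNReal.coe_lt_coe], LipschitzWith.of_dist_le_mul fun y z => ?_⟩
    have := hdiff y y.2 z z.2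
    rw [Subtype.dist_eq, Subtype.dist_eq, dist_eq_norm, dist_eq_norm]
    simp only [Set.MapsTo.val_restrict_apply]
    refine this.trans (le_of_eq ?_)
    norm_num; ring
  obtain ⟨y, hy, hfix, -⟩ := hcon.exists_fixedPoint' Metric.isClosed_closedBall.isComplete hmaps
    (x := 0) (by simp [hε]) (edist_ne_top _ _)
  refine ⟨p y, hp y, fun t ht => ⟨?_, hpW y hy t ht⟩⟩
  have h1 : y ⟨t, ht⟩ = Real.exp (-(2 * L * t)) •
      (x₀ + (∫ σ in (0 : ℝ)..t, F σ (p y σ)) - W t) := by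
    conv_lhs => rw [← hfix]
    rfl
  have h2 : p y t = W t + Real.exp (2 * L * t) • y ⟨t, ht⟩ := by
    simp only [p, Set.projIcc_of_mem hT ht]
  rw [h2, h1, smul_smul, ← Real.exp_add]
  simp

end Shadowing

variable {V : Type*} [NormedAddCommGroup V] [InnerProductSpace ℝ V] [FiniteDimensional ℝ V]
  [MeasurableSpace V] [BorelSpace V]

/-! ### The dispersionless flow and its stability under small dispersion. -/

namespace Weight

variable (w : Weight V)

/-- The flow of the dispersionless equation `i ∂ₜu + |u|⁴u = 0` from real data. -/
theorem exists_dispersionless_path {a : LSq V} {ψ : V → ℝ} (ha : ∀ x, w.eval x a = ψ x) :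
    ∃ W : ℝ → LSq V, W 0 = a ∧ (∀ t, HasDerivAt W (Complex.I • w.nonlin (W t)) t) ∧
      ∀ t x, w.eval x (W t) = Complex.exp (Complex.I * (ψ x) ^ 4 * t) * ψ x := by
  let m : LSq V →L[ℂ] LSq V := w.prodL.flip a
  let M : LSq V →L[ℂ] LSq V := m.comp (m.comp (m.comp m))
  have hm : ∀ x h, w.eval x (m h) = ψ x * w.eval x h := fun x h => by
    change w.eval x (w.prod h a) = _
    rw [eval_prod, ha, mul_comm]
  have hM : ∀ x h, w.eval x (M h) = (ψ x : ℂ) ^ 4 * w.eval x h := fun x h => by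
    change w.eval x (m (m (m (m h)))) = _
    simp only [hm]; ring
  -- As |u| is conserved, the flow solves the linear equation W' = iψ⁴W. Multiplication by ψ⁴ is
  -- bounded on the algebra, so an operator exponential gives a path differentiable in the weighted
  -- norm.
  let W : ℝ → LSq V := fun t => NormedSpace.exp ((t : ℂ) • (Complex.I • M)) a
  have hW' : ∀ t, HasDerivAt W (Complex.I • M (W t)) t := by
    intro t
    have h1 := (hasDerivAt_exp_smul_const' (𝕂 := ℂ) (Complex.I • M) (t : ℂ)).scomp t
      Complex.ofRealCLM.hasDerivAt
    have h2 := ((ContinuousLinearMap.apply ℂ (LSq V) a).restrictScalars ℝ).hasFDerivAt.comp_hasDerivAt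
      t h1
    refine h2.congr_deriv ?_
    simp only [Complex.ofRealCLM_apply, Complex.ofReal_one, one_smul]
    rfl
  have hW0 : W 0 = a := by
    simp only [W, Complex.ofReal_zero]
    rw [zero_smul, NormedSpace.exp_zero]
    rfl
  have heval : ∀ t x, w.eval x (W t) = Complex.exp (Complex.I * (ψ x) ^ 4 * t) * ψ x := by
    intro t x
    have h1 : ∀ t : ℝ, HasDerivAt
        (fun t : ℝ => Complex.exp (-(Complex.I * (ψ x) ^ 4 * t)) * w.eval x (W t)) 0 t := by
      intro t
      have h2 : HasDerivAt (fun t : ℝ => w.eval x (W t)) (w.eval x (Complex.I • M (W t))) t :=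
        ((w.eval x).restrictScalars ℝ).hasFDerivAt.comp_hasDerivAt t (hW' t)
      have h3 : HasDerivAt (fun t : ℝ => -(Complex.I * (ψ x : ℂ) ^ 4 * t))
          (-(Complex.I * (ψ x : ℂ) ^ 4 * 1)) t :=
        ((HasDerivAt.ofReal_comp (hasDerivAt_id t)).const_mul _).neg
      have h4 := h3.cexp.mul h2
      refine h4.congr_deriv ?_
      rw [map_smul, hM, smul_eq_mul]; ring
    have h5 := is_const_of_deriv_eq_zero (fun t => (h1 t).differentiableAt)
      (fun t => (h1 t).deriv) t 0
    simp only [hW0, ha] at h5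
    have h6 : w.eval x (W t) = Complex.exp (Complex.I * (ψ x) ^ 4 * t) *
        (Complex.exp (-(Complex.I * (ψ x) ^ 4 * t)) * w.eval x (W t)) := by
      rw [← mul_assoc, ← Complex.exp_add]; simp
    rw [h6, h5]; simp
  refine ⟨W, hW0, fun t => ?_, heval⟩
  have : w.nonlin (W t) = M (W t) := by
    refine w.eq_of_eval_eq fun x => ?_
    rw [eval_nonlin, hM, heval, norm_mul]
    have h1 : ‖Complex.exp (Complex.I * (ψ x) ^ 4 * t)‖ = 1 := by
      rw [show Complex.I * (ψ x : ℂ) ^ 4 * t = ((ψ x ^ 4 * t : ℝ) : ℂ) * Complex.I by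
        push_cast; ring]
      exact Complex.norm_exp_ofReal_mul_I _
    have h2 : ((|ψ x| : ℝ) : ℂ) ^ 4 = (ψ x : ℂ) ^ 4 := by
      norm_cast
      rw [show (4 : ℕ) = 2 * 2 by rfl, pow_mul, sq_abs, pow_mul]
    rw [h1, one_mul, Complex.norm_real, Real.norm_eq_abs, h2]
  rw [this]
  exact hW' t

/-- For small dispersion `δ`, data close to those of a dispersionless solution `W` launch a solution
which stays close to `W` on a given time interval, uniformly over all weaker weights. -/
theorem exists_solution_near_dispersionless {W : ℝ → LSq V}
    (hW : ∀ t, HasDerivAt W (Complex.I • w.nonlin (W t)) t) (K : ℝ) {T θ : ℝ} (hT : 0 ≤ T)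
    (hθ : 0 < θ) :
    ∃ δ₀ > 0, ∀ (w' : Weight V) (hw : ∀ ξ, w' ξ ≤ w ξ), w'.invNorm ≤ K →
      ∀ δ : ℝ, 0 ≤ δ → δ ≤ δ₀ → ∀ b : LSq V, ‖b‖ ≤ δ₀ →
      ∃ v : ℝ → LSq V, Continuous v ∧ ∀ t ∈ Set.Icc 0 T,
        v t = incl hw (W 0) + b + (∫ σ in (0 : ℝ)..t, Complex.I • w'.interaction (δ * σ) (v σ)) ∧
        ‖v t - incl hw (W t)‖ ≤ θ := by
  have hWc : Continuous W := continuous_iff_continuousAt.2 fun t => (hW t).continuousAt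
  obtain ⟨R, hR⟩ := (isCompact_Icc (a := (0 : ℝ)) (b := T)).exists_bound_of_continuousOn
    hWc.continuousOn
  have hR0 : 0 ≤ R := (norm_nonneg _).trans (hR 0 ⟨le_rfl, hT⟩)
  -- The Lipschitz constant on the ball of radius R + θ sees the weight only through K, hence is
  -- common to all admissible w'.
  let L : ℝ := 5 * (32 * |K|) ^ 4 * (R + θ) ^ 4 + 1
  have hL : 0 < L := by positivity
  -- A bound for the defect of W as a solution with dispersion δ. It is measured in the stronger
  -- space of w and passes to w' because `incl` does not increase norms.
  let E : ℝ → ℝ := fun δ => ∫ σ in (0 : ℝ)..T,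
    ‖w.interaction (δ * σ) (W σ) - w.interaction 0 (W σ)‖
  have hEint : Continuous fun p : ℝ × ℝ =>
      ‖w.interaction (p.1 * p.2) (W p.2) - w.interaction 0 (W p.2)‖ := by
    refine Continuous.norm (Continuous.sub ?_ ?_)
    · exact w.continuous_interaction (continuous_fst.mul continuous_snd) (hWc.comp continuous_snd)
    · exact w.continuous_interaction continuous_const (hWc.comp continuous_snd)
  have hint : ∀ δ : ℝ, Continuous fun σ => w.interaction (δ * σ) (W σ) := fun δ =>
    w.continuous_interaction (continuous_const.mul continuous_id) hWc
  have hint0 : Continuous fun σ => w.interaction 0 (W σ) :=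
    w.continuous_interaction continuous_const hWc
  have hintI : ∀ δ : ℝ, Continuous fun σ => Complex.I • w.interaction (δ * σ) (W σ) :=
    fun δ => (hint δ).fun_const_smul Complex.I
  have hintI0 : Continuous fun σ => Complex.I • w.interaction 0 (W σ) := hint0.fun_const_smul Complex.I
  have hWint : ∀ t, W t = W 0 + ∫ σ in (0 : ℝ)..t, Complex.I • w.interaction 0 (W σ) := by
    intro t
    have h2 := intervalIntegral.integral_eq_sub_of_hasDerivAt (a := 0) (b := t)
      (f' := fun σ => Complex.I • w.interaction 0 (W σ))
      (fun σ _ => by rw [interaction_zero]; exact hW σ) (hintI0.intervalIntegrable _ _)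
    rw [h2]; abel
  have hE : Continuous E :=
    intervalIntegral.continuous_parametric_intervalIntegral_of_continuous' hEint 0 T
  have hE0 : E 0 = 0 := by simp [E]
  -- Chosen so that 2ε e^{2LT} = θ, the radius produced by `exists_solution_near`. One half of ε is
  -- spent on the dispersive defect, the other on b.
  let ε : ℝ := θ / (2 * Real.exp (2 * L * T))
  have hε : 0 < ε := by positivity
  obtain ⟨δ₁, hδ₁, hEδ⟩ := Metric.continuous_iff.1 hE 0 (ε / 2) (by positivity)
  refine ⟨min (δ₁ / 2) (ε / 2), by positivity, fun w' hw hK δ hδ0 hδ b hb => ?_⟩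
  have hEle : E δ ≤ ε / 2 := by
    have h1 := hEδ δ (by
      rw [Real.dist_eq, sub_zero, abs_of_nonneg hδ0]
      have := hδ.trans (min_le_left _ _); linarith)
    rw [hE0, Real.dist_eq, sub_zero] at h1
    exact (le_abs_self _).trans h1.le
  refine exists_solution_near (F := fun t h => Complex.I • w'.interaction (δ * t) h)
    (W := fun t => incl hw (W t)) (L := L) (ε := ε) ?_ ((incl hw).continuous.comp hWc) hT hL hε.le
    (le_of_eq ?_) ?_ ?_
  · exact (w'.continuous_interaction (continuous_const.mul continuous_fst)
      continuous_snd).fun_const_smul Complex.I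
  · simp only [ε]; field_simp
  · intro t ht x y hx hy
    have hb : ∀ z, ‖z - incl hw (W t)‖ ≤ θ → ‖z‖ ≤ R + θ := fun z hz => by
      have h1 := norm_add_le (z - incl hw (W t)) (incl hw (W t))
      rw [sub_add_cancel] at h1
      have h2 := (norm_incl_le hw (W t)).trans (hR t ht)
      linarith
    rw [← smul_sub, norm_smul, Complex.norm_I, one_mul]
    refine (w'.norm_interaction_sub_le (K := 32 * |K|) ?_ (hb x hx) (hb y hy)).trans ?_
    · have := hK.trans (le_abs_self K); linarith
    · gcongr; simp [L]
  · intro t ht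
    have h3 : ∫ σ in (0 : ℝ)..t, Complex.I • w'.interaction (δ * σ) (incl hw (W σ))
        = incl hw (∫ σ in (0 : ℝ)..t, Complex.I • w.interaction (δ * σ) (W σ)) := by
      have h4 : ∀ σ, Complex.I • w'.interaction (δ * σ) (incl hw (W σ))
          = (incl hw).restrictScalars ℝ (Complex.I • w.interaction (δ * σ) (W σ)) := fun σ => by
        rw [interaction_incl]; simp
      simp_rw [h4]
      exact ((incl hw).restrictScalars ℝ).intervalIntegral_comp_comm
        ((hintI δ).intervalIntegrable _ _)
    let D : LSq V := ∫ σ in (0 : ℝ)..t,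
      Complex.I • (w.interaction (δ * σ) (W σ) - w.interaction 0 (W σ))
    have h5 : incl hw (∫ σ in (0 : ℝ)..t, Complex.I • w.interaction (δ * σ) (W σ))
        = incl hw (W t) - incl hw (W 0) + incl hw D := by
      rw [← map_sub, ← map_add]
      congr 1
      simp only [D, smul_sub]
      rw [intervalIntegral.integral_sub ((hintI δ).intervalIntegrable _ _)
        (hintI0.intervalIntegrable _ _), hWint t]
      abel
    have h6 : ‖D‖ ≤ E δ := by
      have hc : Continuous fun σ => ‖w.interaction (δ * σ) (W σ) - w.interaction 0 (W σ)‖ :=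
        ((hint δ).sub hint0).norm
      refine (intervalIntegral.norm_integral_le_integral_norm ht.1).trans ?_
      simp_rw [norm_smul, Complex.norm_I, one_mul]
      exact intervalIntegral.integral_mono_interval le_rfl ht.1 ht.2
        (.of_forall fun σ => norm_nonneg _) (hc.intervalIntegrable _ _)
    have h7 := norm_add_le b (incl hw D)
    have h8 := (norm_incl_le hw D).trans h6
    have h9 := hb.trans (min_le_right _ _)
    rw [h3, h5, show incl hw (W 0) + b + (incl hw (W t) - incl hw (W 0) + incl hw D) - incl hw (W t)
      = b + incl hw D by abel]
    linarith

end Weight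

end QuinticNLS

namespace QuinticNLS

variable {V : Type*} [NormedAddCommGroup V] [InnerProductSpace ℝ V] [FiniteDimensional ℝ V]
  [MeasurableSpace V] [BorelSpace V]

/-! ### Rescaled functions N f(nx) on the Fourier side. -/

section Dilation

open Module

theorem eLpNorm_comp_inv_smul (f : V → ℂ) {n : ℝ} (hn : 0 < n) :
    eLpNorm (fun η => f (n⁻¹ • η)) 2 volume
      = ENNReal.ofReal (n ^ finrank ℝ V) ^ (1 / 2 : ℝ) * eLpNorm f 2 volume := by
  have h1 := (Homeomorph.smulOfNeZero (n⁻¹ : ℝ) (inv_ne_zero hn.ne')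
    : V ≃ₜ V).measurableEmbedding.eLpNorm_map_measure (g := f) (p := 2) (μ := volume)
  have h2 : Measure.map (Homeomorph.smulOfNeZero (n⁻¹ : ℝ) (inv_ne_zero hn.ne') : V ≃ₜ V) volume
      = ENNReal.ofReal (n ^ finrank ℝ V) • (volume : Measure V) := by
    have := Measure.map_addHaar_smul (volume : Measure V) (inv_ne_zero hn.ne')
    rw [inv_pow, inv_inv, abs_of_pos (by positivity)] at this
    exact this
  rw [h2, eLpNorm_smul_measure_of_ne_top (by norm_num)] at h1
  simp only [smul_eq_mul] at h1
  norm_num at h1 ⊢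
  rw [h1]
  rfl

/-- The Fourier transform of `x ↦ N f(n x)` in terms of that of `f`. -/
noncomputable def dilate (N n : ℝ) (g : V → ℂ) : V → ℂ :=
  fun η => ((N * (n ^ finrank ℝ V)⁻¹ : ℝ) : ℂ) * g (n⁻¹ • η)

variable {N n : ℝ}

theorem memLp_comp_inv_smul {g : V → ℂ} (hn : 0 < n) (hg : MemLp g 2 volume) :
    MemLp (fun η => g (n⁻¹ • η)) 2 volume := by
  refine ⟨hg.1.comp_quasiMeasurePreserving ⟨by fun_prop, ?_⟩, ?_⟩
  · rw [Measure.map_addHaar_smul volume (inv_ne_zero hn.ne')]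
    exact Measure.smul_absolutelyContinuous
  · rw [eLpNorm_comp_inv_smul g hn]
    exact ENNReal.mul_lt_top (ENNReal.rpow_lt_top_of_nonneg (by norm_num) ENNReal.ofReal_ne_top) hg.2

theorem memLp_dilate {g : V → ℂ} (hn : 0 < n) (hg : MemLp g 2 volume) :
    MemLp (dilate N n g) 2 volume :=
  (memLp_comp_inv_smul hn hg).const_mul _

theorem integrable_dilate {g : V → ℂ} (hn : 0 < n) (hg : Integrable g volume) :
    Integrable (dilate N n g) volume :=
  (hg.comp_smul (inv_ne_zero hn.ne')).const_mul _

theorem fourierInv_dilate (g : V → ℂ) (hn : 0 < n) (x : V) :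
    𝓕⁻ (dilate N n g) x = N * 𝓕⁻ g (n • x) := by
  have h1 : ∀ η : V, Real.fourierChar (inner ℝ η x) • dilate N n g η
      = ((N * (n ^ finrank ℝ V)⁻¹ : ℝ) : ℂ) *
        (Real.fourierChar (inner ℝ (n⁻¹ • η) (n • x)) • g (n⁻¹ • η)) := fun η => by
    rw [inner_smul_left, inner_smul_right, dilate, Circle.smul_def, Circle.smul_def]
    simp only [conj_trivial, inv_mul_cancel_left₀ hn.ne', smul_eq_mul]
    ring
  rw [Real.fourierInv_eq, Real.fourierInv_eq]
  simp_rw [h1]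
  rw [integral_const_mul, Measure.integral_comp_inv_smul_of_nonneg volume
    (fun η => Real.fourierChar (inner ℝ η (n • x)) • g η) hn.le, Complex.real_smul, ← mul_assoc]
  congr 1
  have : (n : ℂ) ≠ 0 := by exact_mod_cast hn.ne'
  push_cast
  field_simp

theorem integral_dilate_mul (g f : V → ℂ) (hn : 0 < n) :
    ∫ η, dilate N n g η * f η = N * ∫ ξ, g ξ * f (n • ξ) := by
  have h1 : ∀ η : V, dilate N n g η * f η = ((N * (n ^ finrank ℝ V)⁻¹ : ℝ) : ℂ) *
      (g (n⁻¹ • η) * f (n • n⁻¹ • η)) := fun η => by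
    rw [smul_inv_smul₀ hn.ne', dilate]; ring
  simp_rw [h1]
  rw [integral_const_mul, Measure.integral_comp_inv_smul_of_nonneg volume
    (fun η => g η * f (n • η)) hn.le, Complex.real_smul, ← mul_assoc]
  congr 1
  have : (n : ℂ) ≠ 0 := by exact_mod_cast hn.ne'
  push_cast
  field_simp

theorem dilate_congr {g g' : V → ℂ} (hn : 0 < n) (h : g =ᵐ[volume] g') :
    dilate N n g =ᵐ[volume] dilate N n g' := by
  have h1 : Measure.QuasiMeasurePreserving (fun η : V => n⁻¹ • η) volume volume := by
    refine ⟨by fun_prop, ?_⟩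
    rw [Measure.map_addHaar_smul volume (inv_ne_zero hn.ne')]
    exact Measure.smul_absolutelyContinuous
  filter_upwards [h1.ae h] with η hη
  simp only [dilate, hη]

end Dilation

namespace Weight

variable (w : Weight V) {N n : ℝ}

/-- The function `x ↦ N f(n x)`, where `f` is represented by the element `a` of the weighted
space. -/
noncomputable def synth (N : ℝ) (hn : 0 < n) (a : LSq V) : LSq V :=
  𝓕⁻ ((memLp_dilate (N := N) hn (w.memLp_symbol a)).toLp _ : LSq V)

variable (hn : 0 < n)

theorem fourier_synth (a : LSq V) :
    ((𝓕 (w.synth N hn a) : LSq V) : V → ℂ) =ᵐ[volume] dilate N n (w.symbol a) := by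
  rw [synth, FourierTransform.fourier_fourierInv_eq]
  exact MemLp.coeFn_toLp _

theorem synth_ae_eq (a : LSq V) :
    (w.synth N hn a : V → ℂ) =ᵐ[volume] fun x => N * w.eval (n • x) a := by
  filter_upwards [fourierInv_toLp_ae_eq (integrable_dilate (N := N) hn (w.integrable_symbol a))
    (memLp_dilate (N := N) hn (w.memLp_symbol a))] with x hx
  rw [synth, hx, fourierInv_dilate _ hn, eval_eq_fourierInv]

theorem synth_sub (a b : LSq V) : w.synth N hn (a - b) = w.synth N hn a - w.synth N hn b := by
  refine Lp.ext ?_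
  filter_upwards [w.synth_ae_eq (N := N) hn (a - b), w.synth_ae_eq (N := N) hn a,
    w.synth_ae_eq (N := N) hn b, Lp.coeFn_sub (w.synth N hn a) (w.synth N hn b)] with x h1 h2 h3 h4
  rw [h1, h4, Pi.sub_apply, h2, h3, map_sub]; ring

/-- Pairings with test functions move to the frequency side, where Δ² is multiplication by its
symbol. -/
theorem integral_synth_mul (a : LSq V) (φ : SchwartzMap V ℂ) :
    ∫ x, w.synth N hn a x * φ x = N * ∫ ξ, w.symbol a ξ * (𝓕⁻ φ : SchwartzMap V ℂ) (n • ξ) := by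
  have h1 : ∫ x, w.synth N hn a x * φ x = ∫ x, 𝓕⁻ (dilate N n (w.symbol a)) x * φ x := by
    refine integral_congr_ae ?_
    filter_upwards [fourierInv_toLp_ae_eq (integrable_dilate (N := N) hn (w.integrable_symbol a))
      (memLp_dilate (N := N) hn (w.memLp_symbol a))] with x hx
    rw [synth, hx]
  rw [h1, integral_fourierInv_mul_eq (integrable_dilate hn (w.integrable_symbol a)) φ.integrable,
    ← SchwartzMap.fourierInv_coe]
  exact integral_dilate_mul _ _ hn

end Weight

/-! ### Test multipliers and differentiability of the propagator on them. -/

section TestFunctions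

theorem fourierInv_laplacian (φ : SchwartzMap V ℂ) (ξ : V) :
    (𝓕⁻ (Laplacian.laplacian φ) : SchwartzMap V ℂ) ξ
      = -((2 * Real.pi * ‖ξ‖) ^ 2 : ℝ) * (𝓕⁻ φ : SchwartzMap V ℂ) ξ := by
  have h1 : ∀ f : SchwartzMap V ℂ, (𝓕⁻ f : SchwartzMap V ℂ) ξ = (𝓕 f : SchwartzMap V ℂ) (-ξ) :=
    fun f => by
      rw [SchwartzMap.fourierInv_coe, SchwartzMap.fourier_coe, Real.fourierInv_eq_fourier_neg]
  have hg : (fun x : V => ‖x‖ ^ 2).HasTemperateGrowth := by fun_prop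
  rw [h1, h1, SchwartzMap.laplacian_eq_fourierMultiplierCLM,
    SchwartzMap.fourierMultiplierCLM_apply, FourierTransform.fourier_smul,
    FourierTransform.fourier_fourierInv_eq, smul_apply,
    SchwartzMap.smulLeftCLM_apply_apply hg, norm_neg, smul_smul, Complex.real_smul]
  push_cast
  ring

/-- A Schwartz multiplier, dilated by `n`, as a functional on the weighted space. -/
theorem memLp_testMultiplier (w : Weight V) (f : SchwartzMap V ℂ) {n : ℝ} (hn : 0 < n) (k : ℕ) :
    MemLp (fun ξ => ((bilaplaceSymbol ξ : ℂ) ^ k * f (n • ξ)) * ((w ξ : ℂ))⁻¹) 2 volume := by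
  obtain ⟨C, -, hC⟩ := f.decay (4 * k) 0
  have hb : MemLp (fun ξ => (bilaplaceSymbol ξ : ℂ) ^ k * f (n • ξ)) ⊤ volume := by
    refine memLp_top_of_bound (Continuous.aestronglyMeasurable ?_)
      ((2 * Real.pi * n⁻¹) ^ (4 * k) * C) (.of_forall fun ξ => ?_)
    · have h1 : Continuous fun ξ : V => (bilaplaceSymbol ξ : ℂ) :=
        Complex.continuous_ofReal.comp continuous_bilaplaceSymbol
      have h2 := f.continuous
      fun_prop
    · have h1 := hC (n • ξ)
      rw [norm_iteratedFDeriv_zero, norm_smul, Real.norm_of_nonneg hn.le] at h1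
      have h2 : ‖(bilaplaceSymbol ξ : ℂ) ^ k * f (n • ξ)‖
          = (2 * Real.pi * n⁻¹) ^ (4 * k) * ((n * ‖ξ‖) ^ (4 * k) * ‖f (n • ξ)‖) := by
        rw [norm_mul, norm_pow, Complex.norm_real, bilaplaceSymbol,
          Real.norm_of_nonneg (by positivity), ← pow_mul, ← mul_assoc, ← mul_pow]
        congr 2
        field_simp
      rw [h2]
      gcongr
  exact w.memLp_inv.mul hb (r := 2)

/-- Taylor's bound handles |y| ≤ 1; otherwise the triangle inequality gives 2|y| ≤ 2y². -/
theorem norm_exp_mul_I_sub_one_sub_le (y : ℝ) :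
    ‖Complex.exp (y * Complex.I) - 1 - y * Complex.I‖ ≤ 2 * y ^ 2 := by
  have hn : ‖(y : ℂ) * Complex.I‖ = |y| := by simp
  rcases le_total |y| 1 with h | h
  · have h1 := Complex.norm_exp_sub_one_sub_id_le (x := y * Complex.I) (by rwa [hn])
    rw [hn, sq_abs] at h1
    nlinarith [sq_nonneg y]
  · have h1 : ‖Complex.exp (y * Complex.I) - 1‖ ≤ |y| := by
      rw [mul_comm]; exact Real.norm_exp_I_mul_ofReal_sub_one_le
    have h2 := norm_sub_le (Complex.exp (y * Complex.I) - 1) (y * Complex.I)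
    rw [hn] at h2
    nlinarith [sq_abs y]

/-- The second-order remainder of the phase is at most 2(σ - τ)² times the squared symbol of Δ², and
`c` supplies the square integrability of that product. Such decay holds for test multipliers. -/
theorem hasDerivAt_propagator {a b c : LSq V}
    (hb : (b : V → ℂ) =ᵐ[volume] fun ξ => (bilaplaceSymbol ξ : ℂ) * a ξ)
    (hc : (c : V → ℂ) =ᵐ[volume] fun ξ => (bilaplaceSymbol ξ : ℂ) ^ 2 * a ξ) (τ : ℝ) :
    HasDerivAt (fun τ => propagator τ a) (Complex.I • propagator τ b) τ := by
  have key : ∀ σ : ℝ, ‖propagator σ a - propagator τ a - (σ - τ) • Complex.I • propagator τ b‖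
      ≤ 2 * ‖c‖ * ‖(σ - τ) ^ 2‖ := by
    intro σ
    have h1 : ‖propagator σ a - propagator τ a - (σ - τ) • Complex.I • propagator τ b‖
        ≤ ‖((2 * (σ - τ) ^ 2 : ℝ) : ℂ) • c‖ := by
      refine norm_le_of_ae_norm_le ?_
      filter_upwards [Lp.coeFn_sub (propagator σ a - propagator τ a)
        ((σ - τ) • Complex.I • propagator τ b), Lp.coeFn_sub (propagator σ a) (propagator τ a),
        Lp.coeFn_smul (σ - τ) (Complex.I • propagator τ b),
        Lp.coeFn_smul Complex.I (propagator τ b), coeFn_propagator σ a, coeFn_propagator τ a,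
        coeFn_propagator τ b, Lp.coeFn_smul ((2 * (σ - τ) ^ 2 : ℝ) : ℂ) c, hb, hc]
        with ξ h1 h2 h3 h4 h5 h6 h7 h8 h9 h10
      rw [h1, h8, Pi.sub_apply, h2, h3, Pi.sub_apply, h5, h6, Pi.smul_apply, h4, Pi.smul_apply,
        Pi.smul_apply, h7, h9, h10, smul_eq_mul, smul_eq_mul, Complex.real_smul]
      have h11 : phase σ ξ = phase τ ξ *
          Complex.exp (((σ - τ) * bilaplaceSymbol ξ : ℝ) * Complex.I) := by
        rw [phase, phase, ← Complex.exp_add]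
        congr 1; push_cast; ring
      have h12 : phase σ ξ * a ξ - phase τ ξ * a ξ - ((σ - τ : ℝ) : ℂ) *
          (Complex.I * (phase τ ξ * ((bilaplaceSymbol ξ : ℂ) * a ξ)))
          = phase τ ξ * (Complex.exp (((σ - τ) * bilaplaceSymbol ξ : ℝ) * Complex.I) - 1
            - ((σ - τ) * bilaplaceSymbol ξ : ℝ) * Complex.I) * a ξ := by
        rw [h11]; push_cast; ring
      rw [h12, norm_mul, norm_mul, norm_phase, one_mul, norm_mul, norm_mul, norm_pow,
        Complex.norm_real, Complex.norm_real, ← mul_assoc]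
      gcongr
      refine (norm_exp_mul_I_sub_one_sub_le _).trans (le_of_eq ?_)
      rw [Real.norm_of_nonneg (by positivity), Real.norm_eq_abs, sq_abs]; ring
    refine h1.trans (le_of_eq ?_)
    rw [norm_smul, Complex.norm_real, norm_mul]
    norm_num
    ring
  rw [hasDerivAt_iff_isLittleO]
  refine (Asymptotics.IsBigO.of_bound (2 * ‖c‖) (.of_forall key)).trans_isLittleO ?_
  have := Asymptotics.isLittleO_pow_sub_sub τ (m := 2) (by norm_num)
  rw [← Asymptotics.isLittleO_norm_left] at this ⊢
  simpa using this

end TestFunctions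

end QuinticNLS

namespace QuinticNLS

/-! ### From the integral equation to the weak equation. -/

section Generic

variable {V : Type*} [NormedAddCommGroup V] [InnerProductSpace ℝ V] [FiniteDimensional ℝ V]
  [MeasurableSpace V] [BorelSpace V]

/-- The bilinear pairing on `L²`. -/
noncomputable def pairing (V : Type*) [NormedAddCommGroup V] [InnerProductSpace ℝ V]
    [FiniteDimensional ℝ V] [MeasurableSpace V] [BorelSpace V] : LSq V →L[ℂ] LSq V →L[ℂ] ℂ :=
  (ContinuousLinearMap.mul ℂ ℂ).lpPairing volume 2 2

theorem pairing_apply (a b : LSq V) : pairing V a b = ∫ ξ, a ξ * b ξ :=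
  ContinuousLinearMap.lpPairing_eq_integral _ _ _

theorem pairing_propagator (τ : ℝ) (a b : LSq V) :
    pairing V (propagator τ a) b = pairing V a (propagator τ b) := by
  rw [pairing_apply, pairing_apply]
  refine integral_congr_ae ?_
  filter_upwards [coeFn_propagator τ a, coeFn_propagator τ b] with ξ h1 h2
  rw [h1, h2]; ring

theorem propagator_propagator_neg (τ : ℝ) (a : LSq V) : propagator τ (propagator (-τ) a) = a := by
  refine Lp.ext ?_
  filter_upwards [coeFn_propagator τ (propagator (-τ) a), coeFn_propagator (-τ) a] with ξ h1 h2
  rw [h1, h2, ← mul_assoc, mul_comm (phase τ ξ), phase_neg_mul_phase, one_mul]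

/-- The curve τ ↦ `propagator (δ * τ) (v τ)` need not be differentiable in the weighted space. The
propagator is symmetric for the bilinear pairing, so it is moved onto the decaying multiplier, and
the product rule then involves two differentiable curves. -/
theorem hasDerivWithinAt_integral_symbol (w : Weight V) {v : ℝ → LSq V} (hv : Continuous v)
    {T δ : ℝ} {x₀ : LSq V} (hsol : ∀ t ∈ Set.Icc 0 T,
      v t = x₀ + ∫ σ in (0 : ℝ)..t, Complex.I • w.interaction (δ * σ) (v σ))
    (f : SchwartzMap V ℂ) {n : ℝ} (hn : 0 < n) {t : ℝ} (ht : t ∈ Set.Icc 0 T) :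
    HasDerivWithinAt (fun τ => ∫ ξ, w.symbol (propagator (δ * τ) (v τ)) ξ * f (n • ξ))
      (Complex.I * (δ * ∫ ξ, w.symbol (propagator (δ * t) (v t)) ξ *
          (bilaplaceSymbol ξ * f (n • ξ))) +
        Complex.I * ∫ ξ, w.symbol (w.nonlin (propagator (δ * t) (v t))) ξ * f (n • ξ))
      (Set.Icc 0 T) t := by
  -- `χ 0` is the test vector, `χ 1` gives its derivative along the group, and `χ 2` controls the
  -- Taylor remainder.
  let χ : ℕ → LSq V := fun k => (memLp_testMultiplier w f hn k).toLp _
  have hχ : ∀ k, (χ k : V → ℂ) =ᵐ[volume]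
      fun ξ => ((bilaplaceSymbol ξ : ℂ) ^ k * f (n • ξ)) * ((w ξ : ℂ))⁻¹ := fun k =>
    MemLp.coeFn_toLp _
  have hpair : ∀ k h, pairing V (χ k) h
      = ∫ ξ, w.symbol h ξ * ((bilaplaceSymbol ξ : ℂ) ^ k * f (n • ξ)) := by
    intro k h
    rw [pairing_apply]
    refine integral_congr_ae ?_
    filter_upwards [hχ k] with ξ hξ
    rw [hξ, Weight.symbol]; ring
  have hcont : Continuous fun σ => Complex.I • w.interaction (δ * σ) (v σ) :=
    (w.continuous_interaction (continuous_const.mul continuous_id) hv).fun_const_smul Complex.I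
  have hv' : HasDerivWithinAt v (Complex.I • w.interaction (δ * t) (v t)) (Set.Icc 0 T) t := by
    have h1 := ((hcont.integral_hasStrictDerivAt 0 t).hasDerivAt.const_add x₀).hasDerivWithinAt
      (s := Set.Icc 0 T)
    exact h1.congr hsol (hsol t ht)
  have hb : (χ 1 : V → ℂ) =ᵐ[volume] fun ξ => (bilaplaceSymbol ξ : ℂ) * χ 0 ξ := by
    filter_upwards [hχ 0, hχ 1] with ξ h0 h1
    rw [h0, h1]; ring
  have hc : (χ 2 : V → ℂ) =ᵐ[volume] fun ξ => (bilaplaceSymbol ξ : ℂ) ^ 2 * χ 0 ξ := by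
    filter_upwards [hχ 0, hχ 2] with ξ h0 h1
    rw [h0, h1]; ring
  have hS : HasDerivWithinAt (fun τ => propagator (δ * τ) (χ 0))
      (δ • Complex.I • propagator (δ * t) (χ 1)) (Set.Icc 0 T) t := by
    have h1 : HasDerivAt (fun τ => δ * τ) δ t := by
      simpa using (hasDerivAt_id t).const_mul δ
    exact ((hasDerivAt_propagator hb hc (δ * t)).scomp t h1).hasDerivWithinAt
  let B : LSq V →L[ℝ] LSq V →L[ℝ] ℂ := (pairing V).bilinearRestrictScalars ℝ
  have hB : ∀ a b, B a b = pairing V a b := fun _ _ => rfl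
  have hD := B.hasDerivWithinAt_of_bilinear hS hv'
  simp only [hB] at hD
  have h0 : ∀ τ, pairing V (propagator (δ * τ) (χ 0)) (v τ)
      = ∫ ξ, w.symbol (propagator (δ * τ) (v τ)) ξ * f (n • ξ) := fun τ => by
    rw [pairing_propagator, hpair]; simp
  simp only [h0] at hD
  refine hD.congr_deriv ?_
  have h1 : δ • Complex.I • propagator (δ * t) (χ 1)
      = ((δ : ℂ) * Complex.I) • propagator (δ * t) (χ 1) := by
    rw [mul_smul, Complex.coe_smul]
    rfl
  rw [map_smul, pairing_propagator, hpair, Weight.interaction, propagator_propagator_neg, h1,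
    map_smul, smul_apply, pairing_propagator, hpair]
  simp only [pow_zero, pow_one, one_mul, smul_eq_mul]
  ring

end Generic

/-! ### Return to the original equation. -/

section Solution

variable {d : ℕ}

variable (w : Weight (EuclideanSpace ℝ (Fin d))) {N n : ℝ}

/-- C may depend on n, N and w: it serves only the qualitative continuity in H². -/
theorem sobolevNorm_synth_le (hn : 0 < n) :
    ∃ C : ℝ≥0∞, C ≠ ⊤ ∧ ∀ a : L2 d, sobolevNorm 2 (w.synth N hn a) ≤ C * ‖a‖ₑ := by
  let c : ℝ := |N * (n ^ Module.finrank ℝ (EuclideanSpace ℝ (Fin d)))⁻¹| * ((1 + n ^ 2) * w.lower⁻¹)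
  have hc : 0 ≤ c := by have := w.lower_pos; positivity
  refine ⟨ENNReal.ofReal c * ENNReal.ofReal (n ^ Module.finrank ℝ (EuclideanSpace ℝ (Fin d))) ^ (1 / 2 : ℝ),
    ENNReal.mul_ne_top ENNReal.ofReal_ne_top
      (ENNReal.rpow_ne_top_of_nonneg (by norm_num) ENNReal.ofReal_ne_top), fun a => ?_⟩
  rw [mul_assoc, Lp.enorm_def, ← eLpNorm_comp_inv_smul (a : (EuclideanSpace ℝ (Fin d)) → ℂ) hn, sobolevNorm]
  refine eLpNorm_le_mul_eLpNorm_of_ae_le_mul (F := ℂ) (G := ℂ) ?_ 2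
  filter_upwards [w.fourier_synth (N := N) hn a] with η hη
  rw [hη, dilate, Weight.symbol, norm_mul, norm_mul, norm_mul, norm_inv, Complex.norm_real,
    Complex.norm_real, Complex.norm_real, Real.norm_of_nonneg (w.pos _).le]
  have h1 : ‖(1 + (2 * Real.pi * ‖η‖) ^ 2) ^ ((2 : ℝ) / 2)‖ = 1 + (2 * Real.pi * ‖η‖) ^ 2 := by
    rw [div_self two_ne_zero, Real.rpow_one, Real.norm_of_nonneg (by positivity)]
  have h2 : 1 + (2 * Real.pi * ‖η‖) ^ 2 ≤ (1 + n ^ 2) * w.lower⁻¹ * w (n⁻¹ • η) := by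
    have h3 := w.lower_le (n⁻¹ • η)
    rw [norm_smul, Real.norm_of_nonneg (inv_nonneg.2 hn.le)] at h3
    have h4 : n * (n⁻¹ * ‖η‖) = ‖η‖ := mul_inv_cancel_left₀ hn.ne' _
    generalize n⁻¹ * ‖η‖ = y at h3 h4
    have h5 : 1 + (2 * Real.pi * y) ^ 2 ≤ w.lower⁻¹ * w (n⁻¹ • η) := by
      rw [le_inv_mul_iff₀ w.lower_pos]; exact h3
    rw [← h4, mul_assoc (1 + n ^ 2)]
    refine le_trans ?_ (mul_le_mul_of_nonneg_left h5 (by positivity))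
    nlinarith [sq_nonneg (2 * Real.pi * y), sq_nonneg n]
  have hw := w.pos (n⁻¹ • η)
  rw [h1, Real.norm_eq_abs]
  calc _ ≤ ((1 + n ^ 2) * w.lower⁻¹ * w (n⁻¹ • η)) *
        (|N * (n ^ Module.finrank ℝ (EuclideanSpace ℝ (Fin d)))⁻¹| * (‖a (n⁻¹ • η)‖ * (w (n⁻¹ • η))⁻¹)) := by gcongr
    _ = c * ‖a (n⁻¹ • η)‖ * (w (n⁻¹ • η) * (w (n⁻¹ • η))⁻¹) := by ring
    _ = c * ‖a (n⁻¹ • η)‖ := by rw [mul_inv_cancel₀ hw.ne', mul_one]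

theorem continuousOnHs_synth (hn : 0 < n) {z : ℝ → L2 d} (hz : Continuous z) (J : Set ℝ) :
    ContinuousOnHs 2 J fun t => w.synth N hn (z t) := by
  obtain ⟨C, hC, hCle⟩ := sobolevNorm_synth_le (N := N) w hn
  refine ⟨fun t _ => (hCle _).trans_lt (ENNReal.mul_lt_top hC.lt_top enorm_lt_top), fun t _ => ?_⟩
  have h1 : ∀ τ, sobolevNorm 2 (w.synth N hn (z τ) - w.synth N hn (z t)) ≤ C * ‖z τ - z t‖ₑ :=
    fun τ => by rw [← w.synth_sub]; exact hCle _
  refine tendsto_of_tendsto_of_tendsto_of_le_of_le tendsto_const_nhds ?_ (fun _ => zero_le) h1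
  have h2 : Continuous fun τ => C * ‖z τ - z t‖ₑ :=
    (ENNReal.continuous_const_mul hC).comp (hz.sub continuous_const).enorm
  have h3 := (h2.tendsto t).mono_left (nhdsWithin_le_nhds (s := J))
  simpa using h3

/-- A solution of the rescaled equation in the interaction representation gives a solution of the
quintic fourth order equation. -/
theorem isSolution_synth (hN : 0 < N) (hn : 0 < n) {δ : ℝ} (hδ : δ * N ^ 4 = n ^ 4)
    {v : ℝ → L2 d} (hv : Continuous v) {T : ℝ} {x₀ : L2 d} (hsol : ∀ t ∈ Set.Icc 0 T,
      v t = x₀ + ∫ σ in (0 : ℝ)..t, Complex.I • w.interaction (δ * σ) (v σ)) :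
    IsSolution 1 (T / N ^ 4)
      fun t => w.synth N hn (propagator (δ * (N ^ 4 * t)) (v (N ^ 4 * t))) := by
  let z : ℝ → L2 d := fun t => propagator (δ * t) (v t)
  have hz : Continuous z := continuous_propagator (continuous_const.mul continuous_id) hv
  have hNT : Set.MapsTo (fun t => N ^ 4 * t) (Set.Icc 0 (T / N ^ 4)) (Set.Icc 0 T) := by
    intro t ht
    refine ⟨mul_nonneg (by positivity) ht.1, ?_⟩
    have := ht.2
    rwa [le_div_iff₀ (by positivity), mul_comm] at this
  have hu : ∀ t, (w.synth N hn (z t) : (EuclideanSpace ℝ (Fin d)) → ℂ) =ᵐ[volume] fun x => N * w.eval (n • x) (z t) :=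
    fun t => w.synth_ae_eq hn (z t)
  have hnl : ∀ a : L2 d, (fun x : (EuclideanSpace ℝ (Fin d)) => (‖w.synth N hn a x‖ : ℂ) ^ 4 * w.synth N hn a x)
      =ᵐ[volume] fun x => (N : ℂ) ^ 4 * w.synth N hn (w.nonlin a) x := by
    intro a
    filter_upwards [w.synth_ae_eq (N := N) hn a, w.synth_ae_eq (N := N) hn (w.nonlin a)]
      with x h1 h2
    rw [h1, h2, w.eval_nonlin, norm_mul, Complex.norm_real, Real.norm_of_nonneg hN.le]
    push_cast; ring
  refine ⟨continuousOnHs_synth w hn (z := fun t => z (N ^ 4 * t))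
    (hz.comp (continuous_const.mul continuous_id)) _, fun t _ => ?_, fun φ hφ hφc t ht => ?_⟩
  · refine LocallyIntegrable.congr ?_ (hnl (z (N ^ 4 * t))).symm
    exact ((Lp.memLp _).locallyIntegrable (by norm_num)).smul ((N : ℂ) ^ 4)
  · let φ' : SchwartzMap (EuclideanSpace ℝ (Fin d)) ℂ := hφc.toSchwartzMap hφ
    have hφ' : ∀ x, φ x = φ' x := fun x => rfl
    have hlap : ∀ x, Laplacian.laplacian (Laplacian.laplacian φ) x
        = (Laplacian.laplacian (Laplacian.laplacian φ') : SchwartzMap (EuclideanSpace ℝ (Fin d)) ℂ) x := by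
      intro x
      have h1 : Laplacian.laplacian φ = (Laplacian.laplacian φ' : SchwartzMap (EuclideanSpace ℝ (Fin d)) ℂ) := by
        ext y; rw [SchwartzMap.laplacian_apply]; rfl
      rw [h1, SchwartzMap.laplacian_apply]
    let f : SchwartzMap (EuclideanSpace ℝ (Fin d)) ℂ := 𝓕⁻ φ'
    have h1 := hasDerivWithinAt_integral_symbol w hv hsol f hn (hNT ht)
    have h2 : HasDerivWithinAt (fun t : ℝ => N ^ 4 * t) (N ^ 4) (Set.Icc 0 (T / N ^ 4)) t := by
      simpa using ((hasDerivAt_id t).const_mul (N ^ 4)).hasDerivWithinAt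
    have h3 := ((h1.scomp t h2 hNT).const_mul (N : ℂ))
    have h4 : ∀ a : L2 d, ∫ x, w.synth N hn a x * φ x = N * ∫ ξ, w.symbol a ξ * f (n • ξ) :=
      fun a => by simp_rw [hφ']; exact w.integral_synth_mul hn a φ'
    simp only [h4]
    refine h3.congr_deriv ?_
    have h5 : ∫ x, w.synth N hn (z (N ^ 4 * t)) x * Laplacian.laplacian (Laplacian.laplacian φ) x
        = N * ((n : ℂ) ^ 4 * ∫ ξ, w.symbol (z (N ^ 4 * t)) ξ * (bilaplaceSymbol ξ * f (n • ξ))) := by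
      simp_rw [hlap]
      rw [w.integral_synth_mul, ← integral_const_mul ((n : ℂ) ^ 4)]
      refine congrArg (fun y : ℂ => N * y) (integral_congr_ae (.of_forall fun ξ => ?_))
      beta_reduce
      rw [fourierInv_laplacian, fourierInv_laplacian, norm_smul, Real.norm_of_nonneg hn.le,
        bilaplaceSymbol]
      push_cast; ring
    have h6 : ∫ x, (‖w.synth N hn (z (N ^ 4 * t)) x‖ : ℂ) ^ 4 * w.synth N hn (z (N ^ 4 * t)) x * φ x
        = (N : ℂ) ^ 4 * (N * ∫ ξ, w.symbol (w.nonlin (z (N ^ 4 * t))) ξ * f (n • ξ)) := by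
      rw [← h4, ← integral_const_mul]
      refine integral_congr_ae ?_
      filter_upwards [hnl (z (N ^ 4 * t))] with x hx
      rw [hx]; ring
    -- Δ² on the dilated function produces n⁴ and the change of time produces N⁴; these match
    -- through δN⁴ = n⁴, and the quintic term carries N⁴ on both sides.
    rw [h5, h6, ← Complex.ofReal_pow n, ← hδ]
    simp only [z, Complex.real_smul]
    push_cast; ring

end Solution

end QuinticNLS

namespace QuinticNLS

/-! ### Escape of mass to high frequencies by Wiener averaging. -/

section Wiener

theorem tendsto_average_pow {z : ℂ} (hz : ‖z‖ = 1) (hz1 : z ≠ 1) :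
    Tendsto (fun K : ℕ => (K : ℂ)⁻¹ * ∑ k ∈ Finset.range K, z ^ k) atTop (𝓝 0) := by
  have h1 : ∀ K : ℕ, ‖(K : ℂ)⁻¹ * ∑ k ∈ Finset.range K, z ^ k‖ ≤ (K : ℝ)⁻¹ * (2 / ‖z - 1‖) := by
    intro K
    rw [geom_sum_eq hz1, norm_mul, norm_inv, Complex.norm_natCast, norm_div]
    gcongr
    refine (norm_sub_le _ _).trans ?_
    rw [norm_pow, hz]; norm_num
  refine squeeze_zero_norm h1 ?_
  simpa using tendsto_inv_atTop_nhds_zero_nat.mul_const (2 / ‖z - 1‖)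

theorem norm_average_pow_le {z : ℂ} (hz : ‖z‖ = 1) (K : ℕ) :
    ‖(K : ℂ)⁻¹ * ∑ k ∈ Finset.range K, z ^ k‖ ≤ 1 := by
  rw [norm_mul, norm_inv, Complex.norm_natCast]
  have h1 : ‖∑ k ∈ Finset.range K, z ^ k‖ ≤ K := by
    refine (norm_sum_le _ _).trans ?_
    simp [hz]
  rcases Nat.eq_zero_or_pos K with rfl | hK
  · simp
  · rw [inv_mul_le_iff₀ (by exact_mod_cast hK), mul_one]
    exact h1

/-- Averages of squares of oscillatory integrals tend to zero when the phase has null level sets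
modulo `2π`. -/
theorem tendsto_average_sq_oscillatory {X : Type*} [MeasurableSpace X] {μ : Measure X} [SFinite μ]
    {g z : X → ℂ} (hg : Integrable g μ) (hz : Measurable z) (hz1 : ∀ x, ‖z x‖ = 1)
    (hne : ∀ᵐ p ∂μ.prod μ, z p.1 ≠ z p.2) :
    Tendsto (fun K : ℕ => (K : ℝ)⁻¹ * ∑ k ∈ Finset.range K, ‖∫ x, g x * z x ^ k ∂μ‖ ^ 2)
      atTop (𝓝 0) := by
  -- The squared integral is a double integral of G qᵏ. Almost everywhere q ≠ 1, so the Cesàro means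
  -- of qᵏ tend to 0 there, by summing the geometric series.
  let q : X × X → ℂ := fun p => z p.1 * starRingEnd ℂ (z p.2)
  have hq1 : ∀ p, ‖q p‖ = 1 := fun p => by simp [q, hz1]
  have hqm : Measurable q := by
    have := Complex.continuous_conj.measurable
    exact (hz.comp measurable_fst).mul (this.comp (hz.comp measurable_snd))
  have hq : ∀ p : X × X, z p.1 ≠ z p.2 → q p ≠ 1 := by
    intro p hp h
    apply hp
    have h1 : starRingEnd ℂ (z p.2) * z p.2 = 1 := by
      rw [Complex.conj_mul', hz1]; simp
    calc z p.1 = z p.1 * (starRingEnd ℂ (z p.2) * z p.2) := by rw [h1, mul_one]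
      _ = q p * z p.2 := by simp only [q]; ring
      _ = z p.2 := by rw [h, one_mul]
  let G : X × X → ℂ := fun p => g p.1 * starRingEnd ℂ (g p.2)
  have hgc : Integrable (fun x => starRingEnd ℂ (g x)) μ :=
    hg.norm.mono' (Complex.continuous_conj.comp_aestronglyMeasurable hg.1)
      (.of_forall fun x => by simp)
  have hG : Integrable G (μ.prod μ) := hg.mul_prod hgc
  have hGk : ∀ k : ℕ, Integrable (fun p => G p * q p ^ k) (μ.prod μ) := fun k =>
    hG.mul_bdd (c := 1) (hqm.pow_const k).aestronglyMeasurable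
      (.of_forall fun p => by rw [norm_pow, hq1, one_pow])
  have hsq : ∀ k : ℕ, ((‖∫ x, g x * z x ^ k ∂μ‖ ^ 2 : ℝ) : ℂ)
      = ∫ p, G p * q p ^ k ∂(μ.prod μ) := by
    intro k
    rw [Complex.ofReal_pow, ← Complex.mul_conj', ← integral_conj, ← integral_prod_mul]
    refine integral_congr_ae (.of_forall fun p => ?_)
    simp only [G, q, map_mul, map_pow]; ring
  have hlim : Tendsto (fun K : ℕ => ∫ p, G p * ((K : ℂ)⁻¹ * ∑ k ∈ Finset.range K, q p ^ k)
      ∂(μ.prod μ)) atTop (𝓝 (∫ _p : X × X, (0 : ℂ) ∂(μ.prod μ))) := by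
    refine tendsto_integral_of_dominated_convergence (fun p => ‖G p‖) (fun K => ?_) hG.norm
      (fun K => .of_forall fun p => ?_) ?_
    · exact hG.1.mul (((Finset.measurable_fun_sum _ fun k _ => hqm.pow_const k).const_mul
        _).aestronglyMeasurable)
    · rw [norm_mul]
      exact mul_le_of_le_one_right (norm_nonneg _) (norm_average_pow_le (hq1 p) K)
    · filter_upwards [hne] with p hp
      simpa using (tendsto_average_pow (hq1 p) (hq p hp)).const_mul (G p)
  have heq : ∀ K : ℕ, ∫ p, G p * ((K : ℂ)⁻¹ * ∑ k ∈ Finset.range K, q p ^ k) ∂(μ.prod μ)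
      = (((K : ℝ)⁻¹ * ∑ k ∈ Finset.range K, ‖∫ x, g x * z x ^ k ∂μ‖ ^ 2 : ℝ) : ℂ) := by
    intro K
    rw [Complex.ofReal_mul, Complex.ofReal_sum]
    simp_rw [hsq]
    rw [← integral_finsetSum _ fun k _ => hGk k, ← integral_const_mul]
    refine integral_congr_ae (.of_forall fun p => ?_)
    beta_reduce
    rw [← Finset.mul_sum]
    push_cast; ring
  simp_rw [heq, integral_zero] at hlim
  exact_mod_cast (Complex.continuous_re.tendsto 0).comp hlim

end Wiener

variable {V : Type*} [NormedAddCommGroup V] [InnerProductSpace ℝ V] [FiniteDimensional ℝ V]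
  [MeasurableSpace V] [BorelSpace V]

theorem integral_fourier_mul_eq {f g : V → ℂ} (hf : Integrable f) (hg : Integrable g) :
    ∫ ξ, 𝓕 f ξ * g ξ = ∫ x, f x * 𝓕 g x := by
  have h := VectorFourier.integral_fourierIntegral_smul_eq_flip (L := innerₗ V)
    Real.continuous_fourierChar continuous_inner hf hg
  rw [flip_innerₗ] at h
  exact h

theorem continuous_fourier {f : V → ℂ} (hf : Integrable f) : Continuous (𝓕 f) :=
  VectorFourier.fourierIntegral_continuous Real.continuous_fourierChar (by exact continuous_inner) hf

/-- The Fourier transform on `L²` is given by the Fourier integral on `L¹ ∩ L²`. -/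
theorem fourier_toLp_ae_eq {f : V → ℂ} (hf : Integrable f) (hf2 : MemLp f 2 volume) :
    ((𝓕 (hf2.toLp f) : LSq V) : V → ℂ) =ᵐ[volume] 𝓕 f := by
  refine ae_eq_of_integral_contDiff_smul_eq
    ((Lp.memLp _).locallyIntegrable (by norm_num))
    (continuous_fourier hf).locallyIntegrable fun g hg hgc => ?_
  let gc : V → ℂ := fun x => (g x : ℂ)
  have hgc1 : HasCompactSupport gc := hgc.comp_left (g := fun r : ℝ => (r : ℂ)) (by simp)
  have hgc2 : ContDiff ℝ ∞ gc := Complex.ofRealCLM.contDiff.comp hg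
  let G := hgc1.toSchwartzMap hgc2
  have hG : ∀ x, G x = (g x : ℂ) := fun x => rfl
  have h := congrArg (fun T => T G)
    (Lp.fourier_toTemperedDistribution_eq (hf2.toLp f : LSq V))
  simp only [TemperedDistribution.fourier_apply, Lp.toTemperedDistribution_apply] at h
  have h1 : ∫ x, g x • (𝓕 (hf2.toLp f) : LSq V) x = ∫ x, G x • (𝓕 (hf2.toLp f) : LSq V) x := by
    simp [hG]
  rw [h1, ← h]
  have h2 : ∫ x, (𝓕 G : SchwartzMap V ℂ) x • (hf2.toLp f) x = ∫ x, f x * 𝓕 (G : V → ℂ) x := by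
    refine integral_congr_ae ?_
    filter_upwards [MemLp.coeFn_toLp hf2] with x hx
    rw [hx, SchwartzMap.fourier_coe, smul_eq_mul, mul_comm]
  rw [h2, ← integral_fourier_mul_eq hf (SchwartzMap.integrable (μ := volume) G)]
  refine integral_congr_ae (.of_forall fun x => ?_)
  simp [hG, mul_comm]

/-- Functions `ψ zᵏ` with `|z| = 1` and `z` with null level sets have, for suitable `k`,
arbitrarily small mass at low frequencies. -/
theorem exists_low_frequency_lt {ψ : V → ℂ} {z : V → ℂ} (hψ : Integrable ψ) (hz : Continuous z)
    (hz1 : ∀ x, ‖z x‖ = 1) (hne : ∀ᵐ p ∂(volume : Measure V).prod volume, z p.1 ≠ z p.2) (R : ℝ)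
    {ε : ℝ} (hε : 0 < ε) :
    ∃ k : ℕ, ∫⁻ ξ in Metric.ball 0 R, ‖𝓕 (fun x => ψ x * z x ^ k) ξ‖ₑ ^ (2 : ℝ)
      ≤ ENNReal.ofReal ε := by
  have hint : ∀ k : ℕ, Integrable (fun x => ψ x * z x ^ k) := fun k =>
    hψ.mul_bdd (c := 1) (hz.pow k).aestronglyMeasurable
      (.of_forall fun p => by rw [norm_pow, hz1, one_pow])
  have hcont : ∀ k : ℕ, Continuous (𝓕 fun x => ψ x * z x ^ k) := fun k =>
    continuous_fourier (hint k)
  let C : ℝ := ∫ x, ‖ψ x‖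
  have hb : ∀ k ξ, ‖𝓕 (fun x => ψ x * z x ^ k) ξ‖ ≤ C := fun k ξ => by
    rw [Real.fourier_eq]
    refine (norm_integral_le_integral_norm _).trans (le_of_eq ?_)
    refine integral_congr_ae (.of_forall fun x => ?_)
    simp [hz1]
  have hfin : volume (Metric.ball (0 : V) R) ≠ ⊤ := measure_ball_lt_top.ne
  have : IsFiniteMeasure ((volume : Measure V).restrict (Metric.ball 0 R)) :=
    ⟨by rw [Measure.restrict_apply_univ]; exact measure_ball_lt_top⟩
  have hsqint : ∀ k : ℕ, Integrable (fun ξ => ‖𝓕 (fun x => ψ x * z x ^ k) ξ‖ ^ 2)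
      ((volume : Measure V).restrict (Metric.ball 0 R)) := fun k =>
    (integrable_const (C ^ 2)).mono' ((hcont k).norm.pow 2).aestronglyMeasurable
      (.of_forall fun ξ => by
        rw [norm_pow, norm_norm]
        gcongr
        exact hb k ξ)
  have hptw : ∀ ξ, Tendsto (fun K : ℕ => (K : ℝ)⁻¹ * ∑ k ∈ Finset.range K,
      ‖𝓕 (fun x => ψ x * z x ^ k) ξ‖ ^ 2) atTop (𝓝 0) := by
    intro ξ
    have h1 := tendsto_average_sq_oscillatory (μ := (volume : Measure V))
      (g := fun x => Real.fourierChar (-inner ℝ x ξ) • ψ x) (z := z)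
      ((Real.fourierIntegral_convergent_iff ξ).2 hψ) hz.measurable hz1 hne
    refine h1.congr fun K => ?_
    congr 1
    refine Finset.sum_congr rfl fun k _ => ?_
    rw [Real.fourier_eq]
    simp only [Circle.smul_def, smul_eq_mul, mul_assoc]
  have hlim : Tendsto (fun K : ℕ => ∫ ξ in Metric.ball 0 R, (K : ℝ)⁻¹ * ∑ k ∈ Finset.range K,
      ‖𝓕 (fun x => ψ x * z x ^ k) ξ‖ ^ 2) atTop (𝓝 (∫ _ξ in Metric.ball (0 : V) R, (0 : ℝ))) := by
    refine tendsto_integral_of_dominated_convergence (fun _ => C ^ 2) (fun K => ?_)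
      (integrable_const _) (fun K => .of_forall fun ξ => ?_) (.of_forall hptw)
    · exact (Continuous.mul continuous_const (continuous_finsetSum _ fun k _ =>
        (hcont k).norm.pow 2)).aestronglyMeasurable
    · rw [Real.norm_of_nonneg (by positivity)]
      have h1 : ∑ k ∈ Finset.range K, ‖𝓕 (fun x => ψ x * z x ^ k) ξ‖ ^ 2 ≤ K * C ^ 2 := by
        refine (Finset.sum_le_card_nsmul _ _ (C ^ 2) fun k _ => ?_).trans (le_of_eq (by simp))
        gcongr
        exact hb k ξ
      rcases Nat.eq_zero_or_pos K with rfl | hK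
      · simp; positivity
      · rwa [inv_mul_le_iff₀ (by exact_mod_cast hK)]
  rw [integral_zero] at hlim
  obtain ⟨K, hK, hK0⟩ := ((hlim.eventually_lt_const hε).and (eventually_gt_atTop 0)).exists
  rw [integral_const_mul, integral_finsetSum _ fun k _ => hsqint k] at hK
  -- An average below ε has a term below ε.
  have hex : ∃ k ∈ Finset.range K, ∫ ξ in Metric.ball 0 R, ‖𝓕 (fun x => ψ x * z x ^ k) ξ‖ ^ 2
      < ε := by
    by_contra! hcon
    have h1 := Finset.card_nsmul_le_sum _ _ _ hcon
    rw [Finset.card_range, nsmul_eq_mul] at h1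
    rw [inv_mul_lt_iff₀ (by exact_mod_cast hK0)] at hK
    linarith
  obtain ⟨k, -, hk⟩ := hex
  refine ⟨k, ?_⟩
  have h2 := ofReal_integral_eq_lintegral_ofReal (hsqint k) (.of_forall fun ξ => by positivity)
  have h3 : ∀ ξ, ‖𝓕 (fun x => ψ x * z x ^ k) ξ‖ₑ ^ (2 : ℝ)
      = ENNReal.ofReal (‖𝓕 (fun x => ψ x * z x ^ k) ξ‖ ^ 2) := fun ξ => by
    rw [ENNReal.rpow_two, ENNReal.ofReal_pow (norm_nonneg _), ofReal_norm]
  simp_rw [h3]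
  rw [← h2]
  exact ENNReal.ofReal_le_ofReal hk.le

theorem enorm_sq_eq_lintegral (u : LSq V) : ‖u‖ₑ ^ (2 : ℝ) = ∫⁻ ξ, ‖u ξ‖ₑ ^ (2 : ℝ) := by
  rw [Lp.enorm_def, eLpNorm_eq_lintegral_rpow_enorm_toReal (by norm_num) (by norm_num),
    ← ENNReal.rpow_mul]
  simp

namespace Weight

/-- The dispersionless flow moves a fixed amount of mass to arbitrarily high frequencies. -/
theorem exists_high_frequency (w : Weight V) {W : ℝ → LSq V} {ψ : V → ℝ} (hψc : Continuous ψ)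
    (hψ : Integrable ψ) (hψ2 : MemLp (fun x => (ψ x : ℂ)) 2 volume)
    (hW : ∀ t x, w.eval x (W t) = Complex.exp (Complex.I * (ψ x) ^ 4 * t) * ψ x)
    (hne : ∀ᵐ p ∂(volume : Measure V).prod volume,
      Complex.exp (Complex.I * (ψ p.1) ^ 4) ≠ Complex.exp (Complex.I * (ψ p.2) ^ 4))
    {m : ℝ} (hm : 0 < m) (hmψ : ENNReal.ofReal (2 * m) ≤ ‖hψ2.toLp‖ₑ ^ (2 : ℝ)) (R : ℝ) :
    ∃ k : ℕ, ENNReal.ofReal m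
      ≤ ∫⁻ ξ in (Metric.ball 0 R)ᶜ, ‖w.symbol (W (k + 1 : ℕ)) ξ‖ₑ ^ (2 : ℝ) := by
  have hexp : ∀ (x : V) (k : ℕ), Complex.exp (Complex.I * (ψ x) ^ 4) ^ k
      = Complex.exp (Complex.I * (ψ x) ^ 4 * k) := fun x k => by
    rw [← Complex.exp_nat_mul]; congr 1; ring
  have hz1 : ∀ x, ‖Complex.exp (Complex.I * (ψ x : ℂ) ^ 4)‖ = 1 := fun x => by
    rw [show Complex.I * (ψ x : ℂ) ^ 4 = ((ψ x ^ 4 : ℝ) : ℂ) * Complex.I by push_cast; ring]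
    exact Complex.norm_exp_ofReal_mul_I _
  have hzc : Continuous fun x => Complex.exp (Complex.I * (ψ x : ℂ) ^ 4) := by fun_prop
  -- Applied to ψz instead of ψ, so that the power obtained is k + 1 and the inflation time is
  -- positive.
  obtain ⟨k, hk⟩ := exists_low_frequency_lt
    (hψ.ofReal.mul_bdd (c := 1) hzc.aestronglyMeasurable (.of_forall fun p => (hz1 p).le))
    hzc hz1 hne R hm
  simp only [mul_assoc, ← pow_succ'] at hk
  refine ⟨k, ?_⟩
  let f : V → ℂ := fun x => ψ x * Complex.exp (Complex.I * (ψ x) ^ 4) ^ (k + 1)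
  have hfn : ∀ x, ‖f x‖ = ‖(ψ x : ℂ)‖ := fun x => by simp [f, hz1]
  have hf1 : Integrable f := hψ.ofReal.mul_bdd (c := 1) (hzc.pow (k + 1)).aestronglyMeasurable
      (.of_forall fun p => by rw [norm_pow, hz1, one_pow])
  have hf2 : MemLp f 2 volume := hψ2.of_le hf1.1 (.of_forall fun x => (hfn x).le)
  have hWf : ∀ x, w.eval x (W (k + 1 : ℕ)) = f x := fun x => by
    rw [hW, mul_comm]; simp [f, hexp]
  have hinv : (𝓕⁻ ((w.memLp_symbol (W (k + 1 : ℕ))).toLp _ : LSq V)) = hf2.toLp f := by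
    refine Lp.ext ?_
    filter_upwards [fourierInv_toLp_ae_eq (w.integrable_symbol (W (k + 1 : ℕ))) (w.memLp_symbol (W (k + 1 : ℕ))),
      MemLp.coeFn_toLp hf2] with x h1 h2
    rw [h1, h2, ← eval_eq_fourierInv, hWf]
  have hsym : ((w.memLp_symbol (W (k + 1 : ℕ))).toLp _ : LSq V) = 𝓕 (hf2.toLp f) := by
    rw [← hinv, FourierTransform.fourier_fourierInv_eq]
  have hae : w.symbol (W (k + 1 : ℕ)) =ᵐ[volume] 𝓕 f := by
    have h1 := MemLp.coeFn_toLp (w.memLp_symbol (W (k + 1 : ℕ)))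
    rw [hsym] at h1
    exact h1.symm.trans (fourier_toLp_ae_eq hf1 hf2)
  -- Plancherel and |f| = |ψ|: the total mass is at least 2m, of which at most m is at low
  -- frequency.
  have htot : ∫⁻ ξ, ‖𝓕 f ξ‖ₑ ^ (2 : ℝ) = ‖hψ2.toLp‖ₑ ^ (2 : ℝ) := by
    have h1 : ‖hψ2.toLp‖ₑ = ‖(𝓕 (hf2.toLp f) : LSq V)‖ₑ := by
      rw [← ofReal_norm, ← ofReal_norm, Lp.norm_fourier_eq, Lp.norm_toLp, Lp.norm_toLp,
        eLpNorm_congr_norm_ae (.of_forall hfn)]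
    rw [h1, enorm_sq_eq_lintegral]
    refine lintegral_congr_ae ?_
    filter_upwards [fourier_toLp_ae_eq hf1 hf2] with ξ hξ
    rw [hξ]
  have hsplit := lintegral_add_compl (μ := (volume : Measure V)) (fun ξ => ‖𝓕 f ξ‖ₑ ^ (2 : ℝ))
    (Metric.isOpen_ball (x := (0 : V)) (ε := R)).measurableSet
  have hcongr : ∫⁻ ξ in (Metric.ball 0 R)ᶜ, ‖w.symbol (W (k + 1 : ℕ)) ξ‖ₑ ^ (2 : ℝ)
      = ∫⁻ ξ in (Metric.ball 0 R)ᶜ, ‖𝓕 f ξ‖ₑ ^ (2 : ℝ) := by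
    refine lintegral_congr_ae (ae_restrict_of_ae ?_)
    filter_upwards [hae] with ξ hξ
    rw [hξ]
  rw [hcongr]
  rw [htot] at hsplit
  have h2 : ENNReal.ofReal m + ENNReal.ofReal m
      ≤ ENNReal.ofReal m + ∫⁻ ξ in (Metric.ball 0 R)ᶜ, ‖𝓕 f ξ‖ₑ ^ (2 : ℝ) := by
    rw [← ENNReal.ofReal_add hm.le hm.le, ← two_mul]
    refine hmψ.trans (hsplit.symm.le.trans ?_)
    gcongr
    exact hk
  exact (ENNReal.add_le_add_iff_left ENNReal.ofReal_ne_top).1 h2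

end Weight

end QuinticNLS

namespace QuinticNLS

variable {V : Type*} [NormedAddCommGroup V] [InnerProductSpace ℝ V] [FiniteDimensional ℝ V]
  [MeasurableSpace V] [BorelSpace V]

open Module

/-! ### The weights ν⟨ξ⟩² + |ξ|ʲ(1 + |ξ|²). -/

section PolynomialWeight

/-- The larger of x and y is at least z/2, and doubling the argument costs at most 2ʲ · 4 ≤ 16; this
is the origin of the 16 in `Weight`. -/
theorem pow_mul_le_of_add {j : ℕ} (hj : j ≤ 2) {x y z : ℝ} (hx : 0 ≤ x) (hy : 0 ≤ y) (hz : 0 ≤ z)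
    (h : z ≤ x + y) :
    z ^ j * (1 + z ^ 2) ≤ 16 * (x ^ j * (1 + x ^ 2) + y ^ j * (1 + y ^ 2)) := by
  have key : ∀ a b : ℝ, 0 ≤ a → a ≤ b → z ≤ a + b →
      z ^ j * (1 + z ^ 2) ≤ 16 * (b ^ j * (1 + b ^ 2)) := by
    intro a b ha hab hz'
    have h1 : z ≤ 2 * b := by linarith
    have hb := ha.trans hab
    have h2 : (2 : ℝ) ^ j ≤ 4 := (pow_le_pow_right₀ (by norm_num) hj).trans (by norm_num)
    calc z ^ j * (1 + z ^ 2) ≤ (2 * b) ^ j * (1 + (2 * b) ^ 2) := by gcongr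
      _ = 2 ^ j * (b ^ j * (1 + 4 * b ^ 2)) := by rw [mul_pow]; ring
      _ ≤ 4 * (b ^ j * (4 * (1 + b ^ 2))) := by gcongr; linarith
      _ = _ := by ring
  rcases le_total x y with hxy | hxy
  · have := key x y hx hxy h
    have h3 : 0 ≤ x ^ j * (1 + x ^ 2) := by positivity
    linarith
  · have := key y x hy hxy (by linarith)
    have h3 : 0 ≤ y ^ j * (1 + y ^ 2) := by positivity
    linarith

/-- In polar coordinates the integrand is r^(d-1-2j)(1 + r²)⁻². The bound 2j < d gives integrability
at 0 and d < 2j + 4 at infinity: the exponent is 0, 1 or 2, so (1 + r²)⁻¹ is a majorant. -/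
theorem memLp_inv_pow_mul {j : ℕ} (h1 : 2 * j < finrank ℝ V) (h2 : finrank ℝ V < 2 * j + 4) :
    MemLp (fun ξ : V => (((‖ξ‖ ^ j * (1 + ‖ξ‖ ^ 2) : ℝ) : ℂ))⁻¹) 2 volume := by
  have : Nontrivial V := Module.nontrivial_of_finrank_pos (R := ℝ) (by omega)
  have hm : Measurable fun ξ : V => (((‖ξ‖ ^ j * (1 + ‖ξ‖ ^ 2) : ℝ) : ℂ))⁻¹ := by fun_prop
  rw [memLp_two_iff_integrable_sq_norm hm.aestronglyMeasurable]
  have h3 : ∀ ξ : V, ‖(((‖ξ‖ ^ j * (1 + ‖ξ‖ ^ 2) : ℝ) : ℂ))⁻¹‖ ^ 2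
      = (fun y : ℝ => ((y ^ j * (1 + y ^ 2)) ^ 2)⁻¹) ‖ξ‖ := fun ξ => by
    rw [norm_inv, Complex.norm_real, Real.norm_of_nonneg (by positivity), inv_pow]
  simp_rw [h3]
  rw [integrable_fun_norm_addHaar volume (f := fun y : ℝ => ((y ^ j * (1 + y ^ 2)) ^ 2)⁻¹)]
  refine Integrable.mono' (integrable_inv_one_add_sq.integrableOn) (by fun_prop) ?_
  refine (ae_restrict_mem measurableSet_Ioi).mono fun y hy => ?_
  have hy : 0 < y := hy
  obtain ⟨e, he⟩ : ∃ e, finrank ℝ V - 1 = 2 * j + e := ⟨finrank ℝ V - 1 - 2 * j, by omega⟩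
  have he2 : e ≤ 2 := by omega
  have h4 : y ^ e ≤ 1 + y ^ 2 := by
    rcases le_total y 1 with h | h
    · exact (pow_le_one₀ hy.le h).trans (by nlinarith)
    · exact (pow_le_pow_right₀ h he2).trans (by linarith)
  rw [he, smul_eq_mul, Real.norm_of_nonneg (by positivity), ← div_eq_mul_inv,
    div_le_iff₀ (by positivity)]
  calc y ^ (2 * j + e) = y ^ (2 * j) * y ^ e := pow_add _ _ _
    _ ≤ y ^ (2 * j) * (1 + y ^ 2) := by gcongr
    _ = _ := by field_simp; ring

/-- The weight `ν ⟨ξ⟩² + |ξ|ʲ (1 + |ξ|²)`. -/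
noncomputable def polyWeight {j : ℕ} (hj : j ≤ 2) (h1 : 2 * j < finrank ℝ V)
    (h2 : finrank ℝ V < 2 * j + 4) {ν : ℝ} (hν : 0 < ν) : Weight V where
  toFun ξ := ν * (1 + (2 * Real.pi * ‖ξ‖) ^ 2) + ‖ξ‖ ^ j * (1 + ‖ξ‖ ^ 2)
  continuous_toFun := by fun_prop
  lower := ν
  lower_pos := hν
  lower_le ξ := le_add_of_nonneg_right (by positivity)
  even ξ := by rw [norm_neg]
  add_le ξ η := by
    have h3 := pow_mul_le_of_add hj (norm_nonneg ξ) (norm_nonneg η) (norm_nonneg (ξ + η))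
      (norm_add_le ξ η)
    have h4 : ν * (1 + (2 * Real.pi * ‖ξ + η‖) ^ 2) ≤ 16 * (ν * (1 + (2 * Real.pi * ‖ξ‖) ^ 2)
        + ν * (1 + (2 * Real.pi * ‖η‖) ^ 2)) := by
      rw [← mul_add, mul_left_comm]
      gcongr
      have h5 : (2 * Real.pi * ‖ξ + η‖) ^ 2 ≤ (2 * Real.pi * ‖ξ‖ + 2 * Real.pi * ‖η‖) ^ 2 := by
        have := norm_add_le ξ η
        rw [← mul_add]
        gcongr
      nlinarith [sq_nonneg (2 * Real.pi * ‖ξ‖ - 2 * Real.pi * ‖η‖),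
        sq_nonneg (2 * Real.pi * ‖ξ‖), sq_nonneg (2 * Real.pi * ‖η‖)]
    linarith
  memLp_inv := by
    have : Nontrivial V := Module.nontrivial_of_finrank_pos (R := ℝ) (by omega)
    refine (memLp_inv_pow_mul h1 h2).of_le (by fun_prop) ?_
    -- For j > 0 the comparison weight vanishes at the origin, where its inverse is 0 by convention,
    -- so that point is discarded.
    filter_upwards [(Set.finite_singleton (0 : V)).measure_zero volume |> compl_mem_ae_iff.2]
      with ξ hξ
    have hξ : 0 < ‖ξ‖ := norm_pos_iff.2 hξ
    rw [norm_inv, norm_inv, Complex.norm_real, Complex.norm_real,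
      Real.norm_of_nonneg (by positivity), Real.norm_of_nonneg (by positivity)]
    exact inv_anti₀ (by positivity) (le_add_of_nonneg_left (by positivity))

variable {j : ℕ} (hj : j ≤ 2) (h1 : 2 * j < finrank ℝ V) (h2 : finrank ℝ V < 2 * j + 4)

theorem polyWeight_apply {ν : ℝ} (hν : 0 < ν) (ξ : V) : polyWeight hj h1 h2 hν ξ
    = ν * (1 + (2 * Real.pi * ‖ξ‖) ^ 2) + ‖ξ‖ ^ j * (1 + ‖ξ‖ ^ 2) := rfl

theorem polyWeight_mono {ν ν' : ℝ} (hν : 0 < ν) (hν' : 0 < ν') (h : ν ≤ ν') (ξ : V) :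
    polyWeight hj h1 h2 hν ξ ≤ polyWeight hj h1 h2 hν' ξ := by
  rw [polyWeight_apply, polyWeight_apply]
  gcongr

/-- The bound is free of ν, which makes the algebra constants uniform as ν → 0. -/
theorem invNorm_polyWeight_le {ν : ℝ} (hν : 0 < ν) : (polyWeight hj h1 h2 hν).invNorm ≤
    (eLpNorm (fun ξ : V => (((‖ξ‖ ^ j * (1 + ‖ξ‖ ^ 2) : ℝ) : ℂ))⁻¹) 2 volume).toReal := by
  have : Nontrivial V := Module.nontrivial_of_finrank_pos (R := ℝ) (by omega)
  refine ENNReal.toReal_mono (memLp_inv_pow_mul h1 h2).eLpNorm_ne_top (eLpNorm_mono_ae ?_)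
  filter_upwards [(Set.finite_singleton (0 : V)).measure_zero volume |> compl_mem_ae_iff.2]
    with ξ hξ
  have hξ : 0 < ‖ξ‖ := norm_pos_iff.2 hξ
  rw [norm_inv, norm_inv, Complex.norm_real, Complex.norm_real, polyWeight_apply,
    Real.norm_of_nonneg (by positivity), Real.norm_of_nonneg (by positivity)]
  exact inv_anti₀ (by positivity) (le_add_of_nonneg_left (by positivity))

end PolynomialWeight

/-! ### The Gaussian profile of the bubble. -/

section Gaussian

/-- The Gaussian `e^{-π|x|²}`, its own Fourier transform. -/
noncomputable def gaussian (x : V) : ℝ := Real.exp (-Real.pi * ‖x‖ ^ 2)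

theorem continuous_gaussian : Continuous (gaussian : V → ℝ) := by
  unfold gaussian; fun_prop

theorem integrable_exp_neg_mul_sq_norm {b : ℝ} (hb : 0 < b) :
    Integrable fun x : V => Real.exp (-b * ‖x‖ ^ 2) := by
  have h := (GaussianFourier.integrable_cexp_neg_mul_sq_norm_add (V := V) (b := b)
    (by simpa using hb) 0 0).norm
  refine h.congr (.of_forall fun x => ?_)
  simp only [inner_zero_left, Complex.norm_exp]
  norm_cast
  simp

theorem memLp_exp_neg_mul_sq_norm {b : ℝ} (hb : 0 < b) :
    MemLp (fun x : V => ((Real.exp (-b * ‖x‖ ^ 2) : ℝ) : ℂ)) 2 volume := by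
  rw [memLp_two_iff_integrable_sq_norm (Continuous.aestronglyMeasurable (by fun_prop))]
  refine (integrable_exp_neg_mul_sq_norm (V := V) (b := 2 * b) (by positivity)).congr
    (.of_forall fun x => ?_)
  simp only [Complex.norm_real, Real.norm_eq_abs, Real.abs_exp]
  rw [← Real.exp_nat_mul]
  congr 1; push_cast; ring

theorem fourierInv_gaussian (x : V) :
    (𝓕⁻ (fun ξ : V => (gaussian ξ : ℂ)) : V → ℂ) x = gaussian x := by
  have h := fourier_gaussian_innerProductSpace (V := V) (b := Real.pi)
    (by simpa using Real.pi_pos) (-x)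
  rw [Real.fourierInv_eq_fourier_neg]
  have h2 : (fun ξ : V => (gaussian ξ : ℂ)) = fun v => Complex.exp (-Real.pi * ‖v‖ ^ 2) := by
    ext v; simp [gaussian]
  rw [h2, h]
  have h3 : (Real.pi : ℂ) ≠ 0 := by exact_mod_cast Real.pi_ne_zero
  rw [div_self h3, Complex.one_cpow, one_mul, norm_neg, gaussian]
  push_cast
  congr 1
  field_simp

/-- The fourth power of `gaussian` lies in (0, 1], an interval shorter than 2π, so equal phases
force equal norms. Pairs of equal norm form a null set, its slices being spheres. -/
theorem ae_prod_gaussian_ne [Nontrivial V] : ∀ᵐ p ∂(volume : Measure V).prod (volume : Measure V),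
    Complex.exp (Complex.I * (gaussian p.1) ^ 4) ≠ Complex.exp (Complex.I * (gaussian p.2) ^ 4) := by
  have hs : MeasurableSet {p : V × V | ‖p.1‖ = ‖p.2‖} :=
    (isClosed_eq (by fun_prop) (by fun_prop)).measurableSet
  have h0 : ((volume : Measure V).prod volume) {p : V × V | ‖p.1‖ = ‖p.2‖} = 0 := by
    rw [Measure.measure_prod_null hs]
    refine .of_forall fun x => ?_
    have h1 : Prod.mk x ⁻¹' {p : V × V | ‖p.1‖ = ‖p.2‖} = Metric.sphere 0 ‖x‖ := by
      ext y; simp [eq_comm]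
    change volume (Prod.mk x ⁻¹' {p : V × V | ‖p.1‖ = ‖p.2‖}) = 0
    rw [h1]
    exact Measure.addHaar_sphere _ _ _
  filter_upwards [compl_mem_ae_iff.2 h0] with p hp heq
  apply hp
  have hb : ∀ x : V, 0 < gaussian x ∧ gaussian x ≤ 1 := fun x => ⟨Real.exp_pos _, by
    rw [gaussian, Real.exp_le_one_iff]
    have := Real.pi_pos
    nlinarith [mul_nonneg this.le (sq_nonneg ‖x‖)]⟩
  rw [Complex.exp_eq_exp_iff_exists_int] at heq
  obtain ⟨m, hm⟩ := heq
  have h1 : gaussian p.1 ^ 4 = gaussian p.2 ^ 4 + m * (2 * Real.pi) := by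
    have h2 : Complex.I * (((gaussian p.1 ^ 4 : ℝ) : ℂ)
        - ((gaussian p.2 ^ 4 + m * (2 * Real.pi) : ℝ) : ℂ)) = 0 := by
      push_cast; linear_combination hm
    rw [mul_eq_zero, or_iff_right Complex.I_ne_zero, sub_eq_zero] at h2
    exact_mod_cast h2
  have hm0 : m = 0 := by
    have a1 := pow_le_one₀ (n := 4) (hb p.1).1.le (hb p.1).2
    have a2 := pow_le_one₀ (n := 4) (hb p.2).1.le (hb p.2).2
    have a3 := pow_pos (hb p.1).1 4
    have a4 := pow_pos (hb p.2).1 4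
    have hpi := Real.pi_gt_three
    by_contra hne
    rcases lt_or_gt_of_ne hne with h | h
    · have : (m : ℝ) ≤ -1 := by exact_mod_cast Int.le_sub_one_of_lt h
      nlinarith
    · have : (1 : ℝ) ≤ m := by exact_mod_cast h
      nlinarith
  rw [hm0] at h1
  simp only [Int.cast_zero, zero_mul, add_zero] at h1
  have h2 := (pow_left_inj₀ (hb p.1).1.le (hb p.2).1.le (by norm_num)).1 h1
  rw [gaussian, gaussian, Real.exp_eq_exp] at h2
  have h3 := mul_left_cancel₀ (neg_ne_zero.2 Real.pi_ne_zero) h2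
  exact (pow_left_inj₀ (norm_nonneg _) (norm_nonneg _) (by norm_num)).1 h3

/-- The weight is O((1 + r²)²), hence O(e^{2r²}), and π > 3 leaves the square integrable factor
e^{-r²}. -/
theorem memLp_polyWeight_mul_gaussian {j : ℕ} (hj : j ≤ 2) (h1 : 2 * j < finrank ℝ V)
    (h2 : finrank ℝ V < 2 * j + 4) {ν : ℝ} (hν : 0 < ν) :
    MemLp (fun ξ : V => (polyWeight hj h1 h2 hν ξ : ℂ) * gaussian ξ) 2 volume := by
  refine MemLp.of_le_mul (c := ν * (2 * Real.pi) ^ 2 + 1 + ν)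
    (memLp_exp_neg_mul_sq_norm (V := V) one_pos) ?_ (.of_forall fun ξ => ?_)
  · exact ((Complex.continuous_ofReal.comp (Weight.continuous _)).mul
      (Complex.continuous_ofReal.comp continuous_gaussian)).aestronglyMeasurable
  · rw [norm_mul, Complex.norm_real, Complex.norm_real, Complex.norm_real,
      Real.norm_of_nonneg (Weight.pos _ _).le, Real.norm_of_nonneg (Real.exp_pos _).le,
      Real.norm_of_nonneg (by unfold gaussian; positivity), polyWeight_apply]
    set r := ‖ξ‖ with hr
    have hr0 : 0 ≤ r := norm_nonneg ξ
    have h4 : r ^ j ≤ 1 + r ^ 2 := by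
      rcases le_total r 1 with h | h
      · exact (pow_le_one₀ hr0 h).trans (by nlinarith)
      · exact (pow_le_pow_right₀ h hj).trans (by linarith)
    have h5 : (1 + r ^ 2) ^ 2 ≤ Real.exp (2 * r ^ 2) := by
      have := Real.add_one_le_exp (r ^ 2)
      rw [two_mul, Real.exp_add, ← sq]
      gcongr
      linarith
    have h6 : ν * (1 + (2 * Real.pi * r) ^ 2) + r ^ j * (1 + r ^ 2)
        ≤ (ν * (2 * Real.pi) ^ 2 + 1 + ν) * (1 + r ^ 2) ^ 2 := by
      have a1 : r ^ j * (1 + r ^ 2) ≤ (1 + r ^ 2) ^ 2 := by rw [sq (1 + r ^ 2)]; gcongr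
      have a2 : 1 + r ^ 2 ≤ (1 + r ^ 2) ^ 2 := by nlinarith [sq_nonneg r]
      have a3 : ν * (1 + (2 * Real.pi * r) ^ 2) ≤ (ν * (2 * Real.pi) ^ 2 + ν) * (1 + r ^ 2) := by
        have : 0 ≤ ν * (2 * Real.pi) ^ 2 := by positivity
        nlinarith [mul_nonneg hν.le (sq_nonneg r)]
      have a4 := mul_le_mul_of_nonneg_left a2 (by positivity : 0 ≤ ν * (2 * Real.pi) ^ 2 + ν)
      nlinarith
    calc _ ≤ (ν * (2 * Real.pi) ^ 2 + 1 + ν) * Real.exp (2 * r ^ 2) * gaussian ξ := by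
          have : 0 ≤ gaussian ξ := (Real.exp_pos _).le
          gcongr
          exact h6.trans (by gcongr)
      _ ≤ _ := by
          rw [mul_assoc, gaussian, ← Real.exp_add]
          gcongr
          rw [← hr]
          nlinarith [Real.pi_gt_three, sq_nonneg r]

end Gaussian

/-! ### The truncated background in rescaled variables. -/

section Background

/-- The factor N⁻¹n^(d/2) is n^s/κ in the application and grows with n; smallness must come from B,
the size of the weight on the shrunken set n⁻¹S. -/
theorem exists_weighted_background (w : Weight V) {N n : ℝ} (hN : 0 < N) (hn : 0 < n) (f : LSq V)
    {S : Set V} (hS : MeasurableSet S) {B : ℝ} (hB : ∀ η ∈ S, w (n⁻¹ • η) ≤ B) (hB0 : 0 ≤ B) :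
    ∃ b : LSq V, dilate N n (w.symbol b) =ᵐ[volume] S.indicator f ∧
      ‖b‖ ≤ N⁻¹ * n ^ ((finrank ℝ V : ℝ) / 2) * B * ‖f‖ := by
  let F : V → ℂ := fun η => (w (n⁻¹ • η) : ℂ) * S.indicator f η
  have hFm : AEStronglyMeasurable F volume :=
    (Complex.continuous_ofReal.comp (w.continuous.comp (continuous_const_smul n⁻¹))
      ).aestronglyMeasurable.mul ((Lp.aestronglyMeasurable f).indicator hS)
  have hFle : ∀ η, ‖F η‖ ≤ B * ‖f η‖ := by
    intro η
    by_cases hη : η ∈ S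
    · simp only [F, Set.indicator_of_mem hη, norm_mul, Complex.norm_real,
        Real.norm_of_nonneg (w.pos _).le]
      gcongr
      exact hB η hη
    · simp only [F, Set.indicator_of_notMem hη, mul_zero, norm_zero]
      positivity
  have hF : MemLp F 2 volume := MemLp.of_le_mul (c := B) (Lp.memLp f) hFm (.of_forall hFle)
  have hn' : 0 < n⁻¹ := inv_pos.2 hn
  have hFn : MemLp (fun ξ => F (n • ξ)) 2 volume := by
    have := memLp_comp_inv_smul hn' hF
    rwa [inv_inv] at this
  have hFnn : eLpNorm (fun ξ => F (n • ξ)) 2 volume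
      = ENNReal.ofReal (n⁻¹ ^ finrank ℝ V) ^ (1 / 2 : ℝ) * eLpNorm F 2 volume := by
    have := eLpNorm_comp_inv_smul F hn'
    rwa [inv_inv] at this
  let c : ℂ := ((N⁻¹ * n ^ finrank ℝ V : ℝ) : ℂ)
  refine ⟨c • hFn.toLp _, ?_, ?_⟩
  · have hsym : w.symbol (c • hFn.toLp _) =ᵐ[volume]
        fun ξ => c * F (n • ξ) * ((w ξ : ℂ))⁻¹ := by
      filter_upwards [Lp.coeFn_smul c (hFn.toLp _), MemLp.coeFn_toLp hFn] with ξ h1 h2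
      rw [Weight.symbol, h1, Pi.smul_apply, h2, smul_eq_mul]
    refine (dilate_congr hn hsym).trans (.of_forall fun η => ?_)
    simp only [dilate, F, c, smul_inv_smul₀ hn.ne']
    have h1 := w.ne_zero (n⁻¹ • η)
    have h2 : (N : ℂ) ≠ 0 := by exact_mod_cast hN.ne'
    have h3 : (n : ℂ) ≠ 0 := by exact_mod_cast hn.ne'
    push_cast
    generalize (w (n⁻¹ • η) : ℂ) = z at h1
    field_simp
  · have h1 : ‖hFn.toLp _‖ ≤ n⁻¹ ^ ((finrank ℝ V : ℝ) / 2) * (B * ‖f‖) := by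
      have h2 : eLpNorm F 2 volume ≤ ENNReal.ofReal B * ‖f‖ₑ := by
        rw [Lp.enorm_def]
        exact eLpNorm_le_mul_eLpNorm_of_ae_le_mul (.of_forall hFle) 2
      rw [Lp.norm_toLp, hFnn]
      refine ENNReal.toReal_le_of_le_ofReal (by positivity) ?_
      rw [ENNReal.ofReal_mul (by positivity), ENNReal.ofReal_mul hB0, ofReal_norm,
        ENNReal.ofReal_rpow_of_nonneg (by positivity) (by norm_num), ← Real.rpow_natCast,
        ← Real.rpow_mul hn'.le, mul_one_div]
      gcongr
    rw [norm_smul, Complex.norm_real, Real.norm_of_nonneg (by positivity)]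
    calc _ ≤ N⁻¹ * n ^ finrank ℝ V * (n⁻¹ ^ ((finrank ℝ V : ℝ) / 2) * (B * ‖f‖)) := by gcongr
      _ = N⁻¹ * (n ^ finrank ℝ V * n⁻¹ ^ ((finrank ℝ V : ℝ) / 2)) * B * ‖f‖ := by ring
      _ = _ := by
        rw [Real.inv_rpow hn.le, ← Real.rpow_neg hn.le, ← Real.rpow_natCast, ← Real.rpow_add hn]
        congr 4; ring

end Background

end QuinticNLS

namespace QuinticNLS

variable {V : Type*} [NormedAddCommGroup V] [InnerProductSpace ℝ V] [FiniteDimensional ℝ V]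
  [MeasurableSpace V] [BorelSpace V]

open Module

/-! ### Sobolev norms under rescaling. -/

section Bracket

/-- The Japanese bracket power `⟨2πη⟩ˢ`. -/
noncomputable def bracket (s : ℝ) (η : V) : ℝ := (1 + (2 * Real.pi * ‖η‖) ^ 2) ^ (s / 2)

variable {s : ℝ}

theorem bracket_nonneg (η : V) : 0 ≤ bracket s η := by unfold bracket; positivity

theorem continuous_bracket : Continuous (bracket s : V → ℝ) := by
  unfold bracket
  exact Continuous.rpow_const (by fun_prop) fun η => .inl (by positivity)

theorem bracket_le (hs : s ≤ 2) (η : V) : bracket s η ≤ 1 + (2 * Real.pi * ‖η‖) ^ 2 := by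
  have h : (1 : ℝ) ≤ 1 + (2 * Real.pi * ‖η‖) ^ 2 := le_add_of_nonneg_right (sq_nonneg _)
  exact (Real.rpow_le_rpow_of_exponent_le h (by linarith : s / 2 ≤ 1)).trans (Real.rpow_one _).le

theorem bracket_smul_le (hs : 0 ≤ s) {n : ℝ} (hn : 1 ≤ n) (η : V) :
    bracket s (n • η) ≤ n ^ s * bracket s η := by
  have hn0 : 0 ≤ n := zero_le_one.trans hn
  have h1 : n ^ s = (n ^ 2) ^ (s / 2) := by
    rw [← Real.rpow_natCast, ← Real.rpow_mul hn0]; congr 1; push_cast; ring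
  rw [bracket, bracket, h1, ← Real.mul_rpow (by positivity) (by positivity)]
  refine Real.rpow_le_rpow (by positivity) ?_ (by positivity)
  rw [norm_smul, Real.norm_of_nonneg hn0]
  nlinarith [one_le_pow₀ (n := 2) hn]

theorem rpow_le_bracket (hs : 0 ≤ s) {r : ℝ} (hr : 0 ≤ r) {η : V} (h : r ≤ ‖η‖) :
    r ^ s ≤ bracket s η := by
  have h1 : r ^ s = (r ^ 2) ^ (s / 2) := by
    rw [← Real.rpow_natCast, ← Real.rpow_mul hr]; congr 1; push_cast; ring
  rw [h1, bracket]
  refine Real.rpow_le_rpow (by positivity) ?_ (by positivity)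
  have h2 : r ≤ 2 * Real.pi * ‖η‖ := by nlinarith [Real.pi_gt_three, norm_nonneg η]
  have h3 : r ^ 2 ≤ (2 * Real.pi * ‖η‖) ^ 2 := by gcongr
  linarith

end Bracket

section Scaling

variable {s N n κ : ℝ}

theorem eLpNorm_mul_dilate (m : V → ℝ) (g : V → ℂ) (hn : 0 < n) :
    eLpNorm (fun η => (m η : ℂ) * dilate N n g η) 2 volume =
      ENNReal.ofReal (n ^ ((finrank ℝ V : ℝ) / 2)) *
        eLpNorm (fun ξ => (m (n • ξ) : ℂ) * (((N * (n ^ finrank ℝ V)⁻¹ : ℝ) : ℂ) * g ξ)) 2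
          volume := by
  have h := eLpNorm_comp_inv_smul
    (fun ξ => (m (n • ξ) : ℂ) * (((N * (n ^ finrank ℝ V)⁻¹ : ℝ) : ℂ) * g ξ)) hn
  simp only [smul_inv_smul₀ hn.ne'] at h
  rw [show (fun η => (m η : ℂ) * dilate N n g η) = fun η =>
    (m η : ℂ) * (((N * (n ^ finrank ℝ V)⁻¹ : ℝ) : ℂ) * g (n⁻¹ • η)) from rfl, h,
    ENNReal.ofReal_rpow_of_nonneg (by positivity) (by norm_num), ← Real.rpow_natCast,
    ← Real.rpow_mul hn.le, mul_one_div]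

/-- This fixes the choice of N: all powers of n cancel at the H^s scaling, leaving size κ. -/
theorem dilate_scale_mul (hn : 0 < n) (hN : N = κ * n ^ ((finrank ℝ V : ℝ) / 2 - s)) :
    n ^ ((finrank ℝ V : ℝ) / 2) * (n ^ s * (N * (n ^ finrank ℝ V)⁻¹)) = κ := by
  rw [hN, ← Real.rpow_natCast, ← Real.rpow_neg hn.le]
  calc _ = κ * (n ^ ((finrank ℝ V : ℝ) / 2) * n ^ s * n ^ ((finrank ℝ V : ℝ) / 2 - s)
        * n ^ (-(finrank ℝ V : ℝ))) := by ring
    _ = κ * 1 := by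
      rw [← Real.rpow_add hn, ← Real.rpow_add hn, ← Real.rpow_add hn]
      congr 1
      ring_nf
      exact Real.rpow_zero n
    _ = κ := mul_one κ

theorem eLpNorm_bracket_mul_dilate_le (hs : 0 ≤ s) (hn : 1 ≤ n) (hκ : 0 ≤ κ)
    (hN : N = κ * n ^ ((finrank ℝ V : ℝ) / 2 - s)) (w : Weight V) (hw : ∀ ξ, bracket s ξ ≤ w ξ)
    (a : LSq V) :
    eLpNorm (fun η => (bracket s η : ℂ) * dilate N n (w.symbol a) η) 2 volume
      ≤ ENNReal.ofReal κ * ‖a‖ₑ := by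
  have hn0 : 0 < n := zero_lt_one.trans_le hn
  have hN0 : 0 ≤ N := by rw [hN]; positivity
  rw [eLpNorm_mul_dilate _ _ hn0, Lp.enorm_def, ← dilate_scale_mul hn0 hN,
    ENNReal.ofReal_mul (by positivity), mul_assoc]
  gcongr
  refine eLpNorm_le_mul_eLpNorm_of_ae_le_mul (.of_forall fun ξ => ?_) 2
  rw [norm_mul, norm_mul, Complex.norm_real, Complex.norm_real,
    Real.norm_of_nonneg (bracket_nonneg _), Real.norm_of_nonneg (by positivity), Weight.symbol,
    norm_mul, norm_inv, Complex.norm_real, Real.norm_of_nonneg (w.pos ξ).le]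
  have h1 : bracket s (n • ξ) ≤ n ^ s * w ξ :=
    (bracket_smul_le hs hn ξ).trans (by gcongr; exact hw ξ)
  calc _ ≤ n ^ s * w ξ * (N * (n ^ finrank ℝ V)⁻¹ * (‖a ξ‖ * (w ξ)⁻¹)) := by
        have := (w.pos ξ).le
        gcongr
    _ = _ := by
        have := (w.pos ξ).ne'
        field_simp

/-- At rescaled frequencies beyond R the bracket is at least (nR)^s, whose n^s is exactly absorbed
by the scaling. -/
theorem le_eLpNorm_bracket_mul_dilate (hs : 0 ≤ s) (hn : 0 < n) (hκ : 0 ≤ κ)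
    (hN : N = κ * n ^ ((finrank ℝ V : ℝ) / 2 - s)) {R : ℝ} (hR : 0 ≤ R) (g : V → ℂ) :
    ENNReal.ofReal (κ * R ^ s) * eLpNorm ((Metric.ball 0 R)ᶜ.indicator g) 2 volume
      ≤ eLpNorm (fun η => (bracket s η : ℂ) * dilate N n g η) 2 volume := by
  have hN0 : 0 ≤ N := by rw [hN]; positivity
  rw [eLpNorm_mul_dilate _ _ hn, ← dilate_scale_mul hn hN, mul_assoc,
    ENNReal.ofReal_mul (by positivity), mul_assoc]
  gcongr
  have h1 : ENNReal.ofReal (n ^ s * (N * (n ^ finrank ℝ V)⁻¹) * R ^ s)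
      = ‖((n ^ s * (N * (n ^ finrank ℝ V)⁻¹) * R ^ s : ℝ) : ℂ)‖ₑ := by
    rw [← ofReal_norm, Complex.norm_real, Real.norm_of_nonneg (by positivity)]
  rw [h1, ← eLpNorm_const_smul]
  refine eLpNorm_mono fun ξ => ?_
  rw [Pi.smul_apply, norm_smul]
  by_cases hξ : ξ ∈ (Metric.ball (0 : V) R)ᶜ
  · rw [Set.indicator_of_mem hξ, norm_mul, norm_mul, Complex.norm_real, Complex.norm_real,
      Complex.norm_real, Real.norm_of_nonneg (bracket_nonneg _),
      Real.norm_of_nonneg (by positivity), Real.norm_of_nonneg (by positivity)]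
    have hξ' : R ≤ ‖ξ‖ := by simpa using hξ
    have h2 : n ^ s * R ^ s ≤ bracket s (n • ξ) := by
      rw [← Real.mul_rpow hn.le hR]
      refine rpow_le_bracket hs (by positivity) ?_
      rw [norm_smul, Real.norm_of_nonneg hn.le]
      gcongr
    calc _ = n ^ s * R ^ s * (N * (n ^ finrank ℝ V)⁻¹ * ‖g ξ‖) := by ring
      _ ≤ _ := by gcongr
  · rw [Set.indicator_of_notMem hξ, norm_zero, mul_zero]
    positivity

end Scaling

namespace Weight

variable (w : Weight V)

theorem symbol_add (a b : LSq V) : w.symbol (a + b) =ᵐ[volume] w.symbol a + w.symbol b := by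
  filter_upwards [Lp.coeFn_add a b] with ξ h
  simp only [symbol, h, Pi.add_apply, add_mul]

theorem symbol_sub (a b : LSq V) : w.symbol (a - b) =ᵐ[volume] w.symbol a - w.symbol b := by
  filter_upwards [Lp.coeFn_sub a b] with ξ h
  simp only [symbol, h, Pi.sub_apply, sub_mul]

theorem eLpNorm_indicator_symbol_propagator (S : Set V) (τ : ℝ) (a : LSq V) :
    eLpNorm (S.indicator (w.symbol (propagator τ a))) 2 volume
      = eLpNorm (S.indicator (w.symbol a)) 2 volume := by
  refine eLpNorm_congr_norm_ae ?_
  filter_upwards [coeFn_propagator τ a] with ξ h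
  rw [norm_indicator_eq_indicator_norm, norm_indicator_eq_indicator_norm]
  by_cases hξ : ξ ∈ S
  · simp only [Set.indicator_of_mem hξ, symbol, h, norm_mul, norm_phase, one_mul]
  · simp only [Set.indicator_of_notMem hξ]

theorem eLpNorm_indicator_symbol_le {S : Set V} (hS : MeasurableSet S) {r : ℝ} (hr : 0 < r)
    (hw : ∀ ξ ∈ S, r ≤ w ξ) (a b : LSq V) :
    eLpNorm (S.indicator (w.symbol a)) 2 volume
      ≤ eLpNorm (S.indicator (w.symbol b)) 2 volume + ENNReal.ofReal r⁻¹ * ‖b - a‖ₑ := by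
  have h1 : S.indicator (w.symbol a) =ᵐ[volume]
      S.indicator (w.symbol b) - S.indicator (w.symbol (b - a)) := by
    filter_upwards [w.symbol_sub b a] with ξ h
    by_cases hξ : ξ ∈ S
    · simp [Set.indicator_of_mem hξ, h]
    · simp [Set.indicator_of_notMem hξ]
  rw [eLpNorm_congr_ae h1]
  refine (eLpNorm_sub_le (((w.memLp_symbol b).indicator hS).1)
    (((w.memLp_symbol (b - a)).indicator hS).1) (by norm_num)).trans ?_
  gcongr
  rw [Lp.enorm_def]
  refine eLpNorm_le_mul_eLpNorm_of_ae_le_mul (.of_forall fun ξ => ?_) 2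
  by_cases hξ : ξ ∈ S
  · rw [Set.indicator_of_mem hξ, symbol, norm_mul, norm_inv, Complex.norm_real,
      Real.norm_of_nonneg (w.pos ξ).le, mul_comm]
    gcongr
    exact hw ξ hξ
  · rw [Set.indicator_of_notMem hξ, norm_zero]
    positivity

end Weight

theorem exists_eLpNorm_indicator_compl_closedBall_le {g : V → ℂ} (hg : MemLp g 2 volume)
    {ε : ℝ≥0∞} (hε : ε ≠ 0) :
    ∃ M : ℝ, 0 ≤ M ∧ eLpNorm ((Metric.closedBall 0 M)ᶜ.indicator g) 2 volume ≤ ε := by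
  obtain ⟨h, hc, hle, -, hh⟩ := hg.exists_hasCompactSupport_eLpNorm_sub_le (by norm_num) hε
  obtain ⟨M, hM⟩ := hc.isCompact.isBounded.subset_closedBall (0 : V)
  refine ⟨max M 0, le_max_right _ _, le_trans (eLpNorm_mono fun ξ => ?_) hle⟩
  by_cases hξ : ξ ∈ (Metric.closedBall (0 : V) (max M 0))ᶜ
  · have h0 : h ξ = 0 := image_eq_zero_of_notMem_tsupport fun h' =>
      hξ (Metric.closedBall_subset_closedBall (le_max_left _ _) (hM h'))
    rw [Set.indicator_of_mem hξ, Pi.sub_apply, h0, sub_zero]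
  · rw [Set.indicator_of_notMem hξ, norm_zero]
    positivity

/-- Up to constants the quantities are n^(-4(D/2-s)), n^(-4(D/2-s-1)) and n^(-(j-s)): duration,
dispersion and background. Subcriticality of s to D/2 - 1 makes the second decay, and s < j the
third. -/
theorem exists_scale {κ lam ε δ₀ s A D : ℝ} {j : ℕ} (hκ : 0 < κ) (hε : 0 < ε)
    (hδ : 0 < δ₀) (hsD : s < D / 2 - 1)
    (hsj : s < j) :
    ∃ n : ℝ, 1 ≤ n ∧ lam / (κ * n ^ (D / 2 - s)) ^ 4 < ε ∧
      n ^ 4 / (κ * n ^ (D / 2 - s)) ^ 4 ≤ δ₀ ∧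
      (κ * n ^ (D / 2 - s))⁻¹ * n ^ (D / 2) * (n⁻¹ ^ j * A) ≤ δ₀ := by
  have e1 : ∀ n : ℝ, 0 < n → lam / (κ * n ^ (D / 2 - s)) ^ 4
      = lam / κ ^ 4 * (n ^ (-(D / 2 - s))) ^ 4 := fun n hn => by
    rw [Real.rpow_neg hn.le]; field_simp
  have e2 : ∀ n : ℝ, 0 < n → n ^ 4 / (κ * n ^ (D / 2 - s)) ^ 4
      = (κ ^ 4)⁻¹ * (n ^ (-(D / 2 - s - 1))) ^ 4 := fun n hn => by
    rw [show -(D / 2 - s - 1) = 1 + -(D / 2 - s) by ring, Real.rpow_add hn, Real.rpow_one,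
      Real.rpow_neg hn.le]
    field_simp
  have e3 : ∀ n : ℝ, 0 < n → (κ * n ^ (D / 2 - s))⁻¹ * n ^ (D / 2) * (n⁻¹ ^ j * A)
      = κ⁻¹ * A * n ^ (-(j - s)) := fun n hn => by
    rw [show -((j : ℝ) - s) = -(D / 2 - s) + D / 2 + -j by ring, Real.rpow_add hn,
      Real.rpow_add hn, Real.rpow_neg hn.le, Real.rpow_neg hn.le, Real.rpow_natCast, inv_pow,
      mul_inv]
    ring
  have t : ∀ {c : ℝ}, 0 < c → Tendsto (fun n : ℝ => n ^ (-c)) atTop (𝓝 0) :=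
    fun hc => tendsto_rpow_neg_atTop hc
  have t1 := ((t (by linarith : 0 < D / 2 - s)).pow 4).const_mul (lam / κ ^ 4)
  have t2 := ((t (by linarith : 0 < D / 2 - s - 1)).pow 4).const_mul (κ ^ 4)⁻¹
  have t3 := (t (by linarith : 0 < (j : ℝ) - s)).const_mul (κ⁻¹ * A)
  simp only [ne_eq, OfNat.ofNat_ne_zero, not_false_eq_true, zero_pow, mul_zero] at t1 t2 t3
  obtain ⟨n, hn, h1, h2, h3⟩ := ((eventually_ge_atTop (1 : ℝ)).and
    ((t1.eventually_lt_const hε).and ((t2.eventually_le_const hδ).and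
      (t3.eventually_le_const hδ)))).exists
  have hn0 : 0 < n := zero_lt_one.trans_le hn
  exact ⟨n, hn, (e1 n hn0).trans_lt h1, (e2 n hn0).trans_le h2, (e3 n hn0).trans_le h3⟩

/-- Only the |ξ|ʲ part gains from n; the other part is left to the choice of ν. -/
theorem polyWeight_inv_smul_le {j : ℕ} (hj : j ≤ 2) (h1 : 2 * j < finrank ℝ V)
    (h2 : finrank ℝ V < 2 * j + 4) {ν : ℝ} (hν : 0 < ν) {n M : ℝ} (hn : 1 ≤ n) {η : V}
    (hη : ‖η‖ ≤ M) : polyWeight hj h1 h2 hν (n⁻¹ • η)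
      ≤ ν * (1 + (2 * Real.pi * M) ^ 2) + n⁻¹ ^ j * (M ^ j * (1 + M ^ 2)) := by
  have hn0 : 0 < n := zero_lt_one.trans_le hn
  have h3 : ‖n⁻¹ • η‖ = n⁻¹ * ‖η‖ := by rw [norm_smul, Real.norm_of_nonneg (inv_pos.2 hn0).le]
  have h4 : n⁻¹ * ‖η‖ ≤ M := by
    have := mul_le_of_le_one_left (norm_nonneg η) (inv_le_one_of_one_le₀ hn)
    linarith
  have h5 : 0 ≤ n⁻¹ * ‖η‖ := by positivity
  have h6 : 0 ≤ M := (norm_nonneg η).trans hη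
  rw [polyWeight_apply, h3, ← mul_assoc (n⁻¹ ^ j), ← mul_pow]
  gcongr

theorem pow_le_polyWeight {j : ℕ} (hj : j ≤ 2) (h1 : 2 * j < finrank ℝ V)
    (h2 : finrank ℝ V < 2 * j + 4) {ν : ℝ} (hν : 0 < ν) {R s : ℝ} (hR : 1 ≤ R) (hs : s ≤ j) {ξ : V}
    (hξ : R ≤ ‖ξ‖) : R ^ s ≤ polyWeight hj h1 h2 hν ξ := by
  have hR0 : 0 ≤ R := zero_le_one.trans hR
  calc R ^ s ≤ R ^ (j : ℝ) := Real.rpow_le_rpow_of_exponent_le hR hs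
    _ = R ^ j := Real.rpow_natCast R j
    _ ≤ ‖ξ‖ ^ j := by gcongr
    _ ≤ ‖ξ‖ ^ j * (1 + ‖ξ‖ ^ 2) := le_mul_of_one_le_right (by positivity)
        (le_add_of_nonneg_right (by positivity))
    _ ≤ _ := by rw [polyWeight_apply]; exact le_add_of_nonneg_left (by positivity)

end QuinticNLS

namespace QuinticNLS

/-! ### Choice of parameters and norm inflation. -/

section Inflation

open Module

variable {d : ℕ} {s N n κ : ℝ}

theorem sobolevNorm_eq_bracket (f : L2 d) :
    sobolevNorm s f = eLpNorm (fun η => (bracket s η : ℂ) * (𝓕 f : L2 d) η) 2 volume := rfl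

theorem sobolevNorm_synth (w : Weight (EuclideanSpace ℝ (Fin d))) (hn : 0 < n) (a : L2 d) :
    sobolevNorm s (w.synth N hn a)
      = eLpNorm (fun η => (bracket s η : ℂ) * dilate N n (w.symbol a) η) 2 volume := by
  refine eLpNorm_congr_ae ?_
  filter_upwards [w.fourier_synth (N := N) hn a] with η h
  rw [h, bracket]

/-- On S the background reproduces u₀ exactly, so only the bubble and the tail of u₀ remain. The
bubble is measured with w' since a weight with small ν does not dominate the bracket. -/
theorem sobolevNorm_synth_sub_le {w w' : Weight (EuclideanSpace ℝ (Fin d))}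
    (hw : ∀ ξ, w ξ ≤ w' ξ) (hs : 0 ≤ s) (hn0 : 0 < n) (hn : 1 ≤ n) (hκ : 0 ≤ κ)
    (hN : N = κ * n ^ ((finrank ℝ (EuclideanSpace ℝ (Fin d)) : ℝ) / 2 - s))
    (hw' : ∀ ξ, bracket s ξ ≤ w' ξ) {S : Set (EuclideanSpace ℝ (Fin d))} (hS : MeasurableSet S)
    (a b u₀ : L2 d) (hb : dilate N n (w.symbol b) =ᵐ[volume] S.indicator (𝓕 u₀ : L2 d)) :
    sobolevNorm s (w.synth N hn0 (Weight.incl hw a + b) - u₀) ≤ ENNReal.ofReal κ * ‖a‖ₑ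
      + eLpNorm (Sᶜ.indicator fun η => (bracket s η : ℂ) * (𝓕 u₀ : L2 d) η) 2 volume := by
  have hae : (fun η => (bracket s η : ℂ) *
      (𝓕 (w.synth N hn0 (Weight.incl hw a + b) - u₀) : L2 d) η) =ᵐ[volume]
      (fun η => (bracket s η : ℂ) * dilate N n (w'.symbol a) η)
        - Sᶜ.indicator fun η => (bracket s η : ℂ) * (𝓕 u₀ : L2 d) η := by
    have hsub : (𝓕 (w.synth N hn0 (Weight.incl hw a + b) - u₀) : L2 d)
        = 𝓕 (w.synth N hn0 (Weight.incl hw a + b)) - 𝓕 u₀ :=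
      map_sub (FourierTransform.fourierCLM ℂ (L2 d)) _ _
    rw [hsub]
    filter_upwards [Lp.coeFn_sub (𝓕 (w.synth N hn0 (Weight.incl hw a + b)) : L2 d) (𝓕 u₀),
      w.fourier_synth (N := N) hn0 (Weight.incl hw a + b), hb,
      dilate_congr (N := N) hn0 (w.symbol_add (Weight.incl hw a) b),
      dilate_congr (N := N) hn0 (Weight.symbol_incl hw a)] with η h1 h2 h3 h4 h5
    rw [h1, Pi.sub_apply, Pi.sub_apply, h2, h4, ← h5]
    have h6 : dilate N n (w.symbol (Weight.incl hw a) + w.symbol b) η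
        = dilate N n (w.symbol (Weight.incl hw a)) η + dilate N n (w.symbol b) η := by
      simp only [dilate, Pi.add_apply, mul_add]
    rw [h6, h3]
    by_cases hη : η ∈ S
    · simp [hη]
    · simp [hη, mul_sub]
  have hm : AEStronglyMeasurable (fun η : EuclideanSpace ℝ (Fin d) => (bracket s η : ℂ)) volume :=
    (Complex.continuous_ofReal.comp continuous_bracket).aestronglyMeasurable
  rw [sobolevNorm_eq_bracket, eLpNorm_congr_ae hae]
  refine (eLpNorm_sub_le (hm.mul (memLp_dilate hn0 (w'.memLp_symbol a)).1)
    ((hm.mul (Lp.aestronglyMeasurable _)).indicator hS.compl) (by norm_num)).trans ?_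
  exact add_le_add (eLpNorm_bracket_mul_dilate_le hs hn hκ hN w' hw' a) le_rfl

/-- Beyond R the weight is at least R^s, so a unit error in the weighted space is an L² error of at
most R^(-s); multiplied by κR^s it costs only κ, whatever R. The propagator is unimodular in
frequency and changes nothing. -/
theorem le_sobolevNorm_synth_propagator {w w' : Weight (EuclideanSpace ℝ (Fin d))}
    (hw : ∀ ξ, w ξ ≤ w' ξ) (hs : 0 ≤ s) (hn : 0 < n) (hκ : 0 ≤ κ)
    (hN : N = κ * n ^ ((finrank ℝ (EuclideanSpace ℝ (Fin d)) : ℝ) / 2 - s)) {R : ℝ} (hR : 0 < R)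
    (hwR : ∀ ξ, R ≤ ‖ξ‖ → R ^ s ≤ w ξ) {a v : L2 d} (hv : ‖v - Weight.incl hw a‖ ≤ 1) (τ : ℝ) :
    ENNReal.ofReal (κ * R ^ s) * eLpNorm ((Metric.ball 0 R)ᶜ.indicator (w'.symbol a)) 2 volume
      ≤ sobolevNorm s (w.synth N hn (propagator τ v)) + ENNReal.ofReal κ := by
  have hRs : 0 < R ^ s := Real.rpow_pos_of_pos hR s
  have h1 : eLpNorm ((Metric.ball 0 R)ᶜ.indicator (w'.symbol a)) 2 volume
      = eLpNorm ((Metric.ball 0 R)ᶜ.indicator (w.symbol (Weight.incl hw a))) 2 volume := by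
    refine eLpNorm_congr_ae ?_
    filter_upwards [Weight.symbol_incl hw a] with ξ h
    simp only [Set.indicator, h]
  have h2 : ‖v - Weight.incl hw a‖ₑ ≤ 1 := by
    rw [← ofReal_norm]
    exact ENNReal.ofReal_le_one.2 hv
  have h3 := w.eLpNorm_indicator_symbol_le (S := (Metric.ball 0 R)ᶜ) (r := R ^ s)
    Metric.isOpen_ball.measurableSet.compl hRs (fun ξ hξ => hwR ξ (by simpa using hξ))
    (Weight.incl hw a) v
  rw [h1, sobolevNorm_synth]
  calc _ ≤ ENNReal.ofReal (κ * R ^ s) *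
        (eLpNorm ((Metric.ball 0 R)ᶜ.indicator (w.symbol v)) 2 volume
          + ENNReal.ofReal (R ^ s)⁻¹ * 1) := by
        gcongr
        exact h3.trans (by gcongr)
    _ = ENNReal.ofReal (κ * R ^ s) *
        eLpNorm ((Metric.ball 0 R)ᶜ.indicator (w.symbol (propagator τ v))) 2 volume
          + ENNReal.ofReal κ := by
        rw [mul_add, mul_one, ← ENNReal.ofReal_mul (by positivity), mul_inv_cancel_right₀ hRs.ne',
          w.eLpNorm_indicator_symbol_propagator]
    _ ≤ _ := by
        gcongr
        exact le_eLpNorm_bracket_mul_dilate hs hn hκ hN hR.le _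

/-- Norm inflation from a background truncated to low frequencies plus a concentrated rescaled
Gaussian, whose dispersionless evolution moves mass to high frequencies. -/
theorem normInflationAt_of_polyWeight {j : ℕ} (hj : j ≤ 2) (h1 : 2 * j < d) (h2 : d < 2 * j + 4)
    (hs : 0 < s) (hs2 : s ≤ 2) (hsj : s < j) (hsd : s < (d : ℝ) / 2 - 1) {u₀ : L2 d}
    (hu₀ : MemHs s u₀) : NormInflationAt 1 s u₀ := by
  have hfr : finrank ℝ (EuclideanSpace ℝ (Fin d)) = d := finrank_euclideanSpace_fin
  rw [← hfr] at h1 h2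
  have hnt : Nontrivial (EuclideanSpace ℝ (Fin d)) :=
    Module.nontrivial_of_finrank_pos (R := ℝ) (by omega)
  intro ε hε
  -- The dispersionless path is built once, for ν = 1, and then included in the spaces with ν ≤ 1.
  let w₁ := polyWeight hj h1 h2 one_pos
  have hbw : ∀ ξ, bracket s ξ ≤ w₁ ξ := fun ξ => by
    rw [polyWeight_apply, one_mul]
    exact (bracket_le hs2 ξ).trans (le_add_of_nonneg_right (by positivity))
  let a₀ : L2 d := (memLp_polyWeight_mul_gaussian hj h1 h2 one_pos).toLp _
  have hev : ∀ x, w₁.eval x a₀ = gaussian x := fun x => by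
    rw [Weight.eval_eq_fourierInv, ← fourierInv_gaussian x, Real.fourierInv_eq, Real.fourierInv_eq]
    refine integral_congr_ae ?_
    filter_upwards [MemLp.coeFn_toLp (memLp_polyWeight_mul_gaussian hj h1 h2 one_pos)] with ξ hξ
    have := w₁.ne_zero ξ
    rw [Weight.symbol, hξ, mul_comm (polyWeight hj h1 h2 one_pos ξ : ℂ), mul_inv_cancel_right₀ this]
  obtain ⟨W, hW0, hWd, hWe⟩ := w₁.exists_dispersionless_path hev
  have hmeas : AEStronglyMeasurable (fun η => (bracket s η : ℂ) * (𝓕 u₀ : L2 d) η) volume :=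
    (Complex.continuous_ofReal.comp continuous_bracket).aestronglyMeasurable.mul
      (Lp.aestronglyMeasurable _)
  obtain ⟨M, hM0, hM⟩ := exists_eLpNorm_indicator_compl_closedBall_le (g := fun η =>
    (bracket s η : ℂ) * (𝓕 u₀ : L2 d) η) ⟨hmeas, hu₀⟩ (ε := ENNReal.ofReal (ε / 2))
    (by simpa using hε)
  -- Half of ε pays for the bubble, the other half for the tail of u₀ beyond M.
  let κ : ℝ := ε / 2 / (‖a₀‖ + 1)
  have hκ : 0 < κ := by positivity
  have hκa : κ * ‖a₀‖ < ε / 2 := by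
    rw [div_mul_eq_mul_div, div_lt_iff₀ (by positivity)]
    nlinarith [norm_nonneg a₀]
  have hg2 : MemLp (fun x : EuclideanSpace ℝ (Fin d) => (gaussian x : ℂ)) 2 volume :=
    memLp_exp_neg_mul_sq_norm Real.pi_pos
  have hgne : 0 < ‖hg2.toLp‖ := by
    refine norm_pos_iff.2 fun h0 => ?_
    have h3 := MemLp.coeFn_toLp hg2
    rw [h0] at h3
    obtain ⟨x, hx, hx'⟩ := (h3.symm.and (Lp.coeFn_zero ℂ 2 volume)).exists
    rw [hx'] at hx
    simp [gaussian] at hx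
  let m : ℝ := ‖hg2.toLp‖ ^ 2 / 2
  have hm : 0 < m := by positivity
  have hmg : ENNReal.ofReal (2 * m) ≤ ‖hg2.toLp‖ₑ ^ (2 : ℝ) := by
    rw [← ofReal_norm, ENNReal.ofReal_rpow_of_nonneg (norm_nonneg _) (by norm_num)]
    refine ENNReal.ofReal_le_ofReal (le_of_eq ?_)
    rw [Real.rpow_two]
    ring
  -- The lower bound κR^s√m must survive the loss of κ in the comparison; the extra 1 makes the
  -- final inequality strict.
  obtain ⟨R, hR1, hR⟩ : ∃ R : ℝ, 1 ≤ R ∧ (ε⁻¹ + κ + 1) / (κ * √m) ≤ R ^ s :=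
    ((eventually_ge_atTop 1).and ((tendsto_rpow_atTop hs).eventually_ge_atTop _)).exists
  rw [div_le_iff₀ (by positivity)] at hR
  have hR0 : 0 < R := zero_lt_one.trans_le hR1
  have hgi : Integrable (gaussian : EuclideanSpace ℝ (Fin d) → ℝ) :=
    integrable_exp_neg_mul_sq_norm Real.pi_pos
  obtain ⟨k, hk⟩ := w₁.exists_high_frequency continuous_gaussian hgi hg2 hWe ae_prod_gaussian_ne
    hm hmg R
  obtain ⟨lam, hlam⟩ : ∃ lam : ℝ, lam = ((k + 1 : ℕ) : ℝ) := ⟨_, rfl⟩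
  have hlam0 : 0 < lam := by rw [hlam]; positivity
  rw [← hlam] at hk
  have hhigh : ENNReal.ofReal √m
      ≤ eLpNorm ((Metric.ball 0 R)ᶜ.indicator (w₁.symbol (W lam))) 2 volume := by
    rw [eLpNorm_indicator_eq_eLpNorm_restrict Metric.isOpen_ball.measurableSet.compl,
      eLpNorm_eq_lintegral_rpow_enorm_toReal (by norm_num) (by norm_num), Real.sqrt_eq_rpow,
      ← ENNReal.ofReal_rpow_of_nonneg hm.le (by norm_num)]
    exact ENNReal.rpow_le_rpow hk (by norm_num)
  obtain ⟨δ₀, hδ₀, hsolve⟩ := w₁.exists_solution_near_dispersionless hWd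
    (eLpNorm (fun ξ : EuclideanSpace ℝ (Fin d) => (((‖ξ‖ ^ j * (1 + ‖ξ‖ ^ 2) : ℝ) : ℂ))⁻¹) 2
      volume).toReal hlam0.le one_pos
  obtain ⟨n, hn1, hnε, hnδ, hnb⟩ := exists_scale (lam := lam) (δ₀ := δ₀ / 2) (j := j)
    (A := M ^ j * (1 + M ^ 2) * ‖(𝓕 u₀ : L2 d)‖) hκ hε (by positivity) hsd hsj
  have hn0 : 0 < n := zero_lt_one.trans_le hn1
  set N : ℝ := κ * n ^ ((d : ℝ) / 2 - s) with hNdef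
  have hN0 : 0 < N := by positivity
  have hN : N = κ * n ^ ((finrank ℝ (EuclideanSpace ℝ (Fin d)) : ℝ) / 2 - s) := by rw [hfr]
  let δ : ℝ := n ^ 4 / N ^ 4
  have hδN : δ * N ^ 4 = n ^ 4 := div_mul_cancel₀ _ (by positivity)
  let C : ℝ := N⁻¹ * n ^ ((d : ℝ) / 2) * (1 + (2 * Real.pi * M) ^ 2) * ‖(𝓕 u₀ : L2 d)‖
  have hC : 0 ≤ C := by positivity
  -- C depends on n, which is harmless because δ₀ does not depend on ν. Each part of the weight
  -- contributes at most δ₀/2 to the norm of b.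
  let ν : ℝ := min 1 (δ₀ / 2 / (C + 1))
  have hν : 0 < ν := by positivity
  have hνC : ν * C ≤ δ₀ / 2 := by
    calc ν * C ≤ δ₀ / 2 / (C + 1) * C := by gcongr; exact min_le_right _ _
      _ ≤ δ₀ / 2 := by
        rw [div_mul_eq_mul_div, div_le_iff₀ (by positivity)]
        nlinarith
  let w := polyWeight hj h1 h2 hν
  have hw : ∀ ξ, w ξ ≤ w₁ ξ := polyWeight_mono hj h1 h2 hν one_pos (min_le_left _ _)
  obtain ⟨b, hb, hbn⟩ := exists_weighted_background w hN0 hn0 (𝓕 u₀ : L2 d)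
    (S := Metric.closedBall 0 M) Metric.isClosed_closedBall.measurableSet
    (fun η hη => polyWeight_inv_smul_le hj h1 h2 hν hn1 (by simpa using hη)) (by positivity)
  have hbδ : ‖b‖ ≤ δ₀ := by
    refine hbn.trans ?_
    rw [hfr]
    calc _ = ν * C + N⁻¹ * n ^ ((d : ℝ) / 2) *
          (n⁻¹ ^ j * (M ^ j * (1 + M ^ 2) * ‖(𝓕 u₀ : L2 d)‖)) := by simp only [C]; ring
      _ ≤ δ₀ := by linarith
  obtain ⟨v, hvc, hv⟩ := hsolve w hw (invNorm_polyWeight_le hj h1 h2 hν) δ (by positivity)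
    (by linarith) b hbδ
  have hv0 : v 0 = Weight.incl hw a₀ + b := by
    rw [(hv 0 ⟨le_rfl, hlam0.le⟩).1, intervalIntegral.integral_same, add_zero, hW0]
  have hvl := (hv lam ⟨hlam0.le, le_rfl⟩).2
  refine ⟨lam / N ^ 4, by positivity, _, isSolution_synth w hN0 hn0 hδN hvc fun t ht => (hv t ht).1,
    lam / N ^ 4, by positivity, hnε, le_rfl, ?_, ?_⟩
  · simp only [mul_zero, propagator_zero, hv0]
    refine (sobolevNorm_synth_sub_le hw hs.le hn0 hn1 hκ.le hN hbw
      Metric.isClosed_closedBall.measurableSet a₀ b u₀ hb).trans_lt ?_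
    calc _ ≤ ENNReal.ofReal (κ * ‖a₀‖) + ENNReal.ofReal (ε / 2) := by
          rw [ENNReal.ofReal_mul hκ.le, ofReal_norm]
          gcongr
      _ = ENNReal.ofReal (κ * ‖a₀‖ + ε / 2) := (ENNReal.ofReal_add (by positivity) (by positivity)).symm
      _ < ENNReal.ofReal ε := (ENNReal.ofReal_lt_ofReal_iff hε).2 (by linarith)
  · have h3 := le_sobolevNorm_synth_propagator hw hs.le hn0 hκ.le hN hR0
      (fun ξ hξ => pow_le_polyWeight hj h1 h2 hν hR1 hsj.le hξ) hvl (δ * lam)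
    rw [mul_div_cancel₀ _ (by positivity)]
    have h4 : ENNReal.ofReal (ε⁻¹ + 1) + ENNReal.ofReal κ ≤
        sobolevNorm s (w.synth N hn0 (propagator (δ * lam) (v lam))) + ENNReal.ofReal κ := by
      refine le_trans ?_ ((mul_le_mul_right hhigh _).trans h3)
      rw [← ENNReal.ofReal_add (by positivity) hκ.le, ← ENNReal.ofReal_mul (by positivity)]
      exact ENNReal.ofReal_le_ofReal (by linarith)
    refine lt_of_lt_of_le ?_ ((ENNReal.add_le_add_iff_right ENNReal.ofReal_ne_top).1 h4)
    exact (ENNReal.ofReal_lt_ofReal_iff (by positivity)).2 (by linarith)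

end Inflation

end QuinticNLS

theorem theorem1p2 (d : ℕ) (hd₃ : 3 ≤ d) (hd₅ : d ≤ 5) (s : ℝ) (hs₀ : 0 < s)
    (hs : s < QuinticNLS.sCrit d) (u₀ : QuinticNLS.L2 d) (hu₀ : QuinticNLS.MemHs s u₀) :
    QuinticNLS.NormInflationAt 1 s u₀ := by
  rw [QuinticNLS.sCrit] at hs
  -- The integer j must be at least d/2 - 1, which is 1/2, 1 or 3/2, and satisfy 2j < d < 2j + 4:
  -- hence j = 1, 1, 2.
  obtain rfl | rfl | rfl : d = 3 ∨ d = 4 ∨ d = 5 := by omega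
  · norm_num at hs
    exact QuinticNLS.normInflationAt_of_polyWeight (j := 1) (by norm_num) (by norm_num)
      (by norm_num) hs₀ (by linarith) (by norm_num; linarith) (by norm_num; linarith) hu₀
  · norm_num at hs
    exact QuinticNLS.normInflationAt_of_polyWeight (j := 1) (by norm_num) (by norm_num)
      (by norm_num) hs₀ (by linarith) (by norm_num; linarith) (by norm_num; linarith) hu₀
  · norm_num at hs
    exact QuinticNLS.normInflationAt_of_polyWeight (j := 2) (by norm_num) (by norm_num)
      (by norm_num) hs₀ (by linarith) (by norm_num; linarith) (by norm_num; linarith) hu₀
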